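/- **Theorem.** Let $\Omega=\{\mathbf t=(t_1,t_2,t_3): t_1+t_2+t_3=0,\ -1\le t_1,t_2,t_3<1\}$, and let $L_p=L_p(\Omega)$, $1\le p\le\infty$, be the space of (classes of) complex-valued measurable functions on $\Omega$ with finite norm $\|f\|_p=\bigl(\frac1{|\Omega|}\int_\Omega|f(\mathbf t)|^p\,d\mathbf t\bigr)^{1/p}$ for $p<\infty$, and $\|f\|_\infty=\operatorname{ess\,sup}_{\Omega}|f|$. For integer triples $\mathbf k=(k_1,k_2,k_3)$ with $k_1+k_2+k_3=0$ put $|\mathbf k|=\max_j|k_j|$, $\phi_{\mathbf k}(\mathbf t)=e^{\frac{2\pi i}{3}(k_1t_1+k_2t_2+k_3t_3)}$ and, for $f\in L_1$, $\widehat f(\mathbf k)=\frac1{|\Omega|}\int_\Omega f(\mathbf t)\overline{\phi_{\mathbf k}(\mathbf t)}\,d\mathbf t$. *Radial derivatives.* For an integer $m\ge0$, a function $g\in L_1$ is called the radial derivative $f^{[m]}$ of order $m$ of $f\in L_1$ if $\widehat g(\mathbf k)=0$ for $|\mathbf k|<m$ and $\widehat g(\mathbf k)=\frac{|\mathbf k|!}{(|\mathbf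 k|-m)!}\widehat f(\mathbf k)$ for $|\mathbf k|\ge m$ (so $f^{[0]}=f$). *K-functional.* For $n\in\mathbb N$, $\delta>0$ and $g\in L_1$, $$K_n(\delta,g)_p=\inf\bigl\{\|g-h\|_p+\delta^n\|h^{[n]}\|_p:\ h\in L_1,\ h^{[n]}\text{ exists and belongs to } L_p\bigr\}\in[0,\infty].$$ *Taylor–Abel–Poisson means.* For $r\in\mathbb N$, $0\le\varrho<1$ and $f\in L_1$, $$A_{\varrho,r}(f)(\mathbf t)=\sum_{\nu=0}^\infty\lambda_{\nu,r}(\varrho)\sum_{|\mathbf k|=\nu}\widehat f(\mathbf k)\phi_{\mathbf k}(\mathbf t),$$ where $\lambda_{\nu,r}(\varrho)=1$ for $\nu<r$ and $\lambda_{\nu,r}(\varrho)=\sum_{j=0}^{r-1}\binom{\nu}{j}(1-\varrho)^j\varrho^{\nu-j}$ for $\nu\ge r$. *The class $\mathscr Z$* consists of all continuous strictly increasing functions $\omega$ on $[0,1]$ with $\omega(0)=0$ and $\int_0^\delta\frac{\omega(t)}{t}\,dt=\mathcal O(\omega(\delta))$ as $\delta\to0+$. Let $1\le p\le\infty$, $f\in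 L_p$, $n,r\in\mathbb N=\{1,2,\dots\}$, $n\le r$, and $\omega\in\mathscr Z$. Suppose that the radial derivative $f^{[r-n]}$ exists and $$K_n\bigl(\delta,f^{[r-n]}\bigr)_p=\mathcal O(\omega(\delta)),\qquad \delta\to0+.$$ Then $$\|f-A_{\varrho,r}(f)\|_p=\mathcal O\bigl((1-\varrho)^{r-n}\omega(1-\varrho)\bigr),\qquad \varrho\to1-.$$ -/

import Mathlib

open MeasureTheory Filter Set
open scoped ENNReal Topology

noncomputable section

namespace Hexagon

/-- The homogeneous coordinates `(t₁, t₂, t₃)`, `t₁ + t₂ + t₃ = 0`, of the point of the plane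
`t₁ + t₂ + t₃ = 0` whose first two coordinates are `t = (t₁, t₂)`. Throughout, that plane is
parametrized by `(t₁, t₂) ∈ ℝ × ℝ`, and `dt` is `dt₁ dt₂`. -/
def coord (t : ℝ × ℝ) : Fin 3 → ℝ := ![t.1, t.2, -t.1 - t.2]

/-- The hexagonal domain `Ω`: `t₁ + t₂ + t₃ = 0`, `-1 ≤ t₁, t₂, t₃ < 1`. -/
def Ω : Set (ℝ × ℝ) := {t | ∀ j, -1 ≤ coord t j ∧ coord t j < 1}

/-- The normalized measure `dt / |Ω|` on `Ω`. The space `L_p(Ω)` consists of the `f` with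
`MemLp f p μΩ`, and its norm is `eLpNorm f p μΩ`. -/
def μΩ : Measure (ℝ × ℝ) := (volume Ω)⁻¹ • volume.restrict Ω

/-- The trigonometric monomial `φ_k(t) = exp((2πi/3) k·t)`. -/
def φ (k : Fin 3 → ℤ) (t : ℝ × ℝ) : ℂ :=
  Complex.exp (2 * Real.pi * Complex.I / 3 * ∑ j, (k j : ℂ) * (coord t j : ℂ))

/-- The Fourier coefficient `⟨f, φ_k⟩ = (1/|Ω|) ∫_Ω f(t) conj(φ_k(t)) dt`. -/
def fourierCoeff (f : ℝ × ℝ → ℂ) (k : Fin 3 → ℤ) : ℂ :=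
  ∫ t, f t * (starRingEnd ℂ) (φ k t) ∂μΩ

/-- `|k| = max_j |k_j|`. -/
def maxAbs (k : Fin 3 → ℤ) : ℕ := Finset.univ.sup fun j => (k j).natAbs

/-- The finite set of the integer triples `k` with `k₁ + k₂ + k₃ = 0` and `|k| = ν`. -/
def J (ν : ℕ) : Finset (Fin 3 → ℤ) :=
  (Fintype.piFinset fun _ : Fin 3 => Finset.Icc (-(ν : ℤ)) (ν : ℤ)).filter
    fun k => ∑ j, k j = 0 ∧ maxAbs k = ν

/-- The coefficients `λ_{ν,r}(ϱ)`. -/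
def lam (r ν : ℕ) (ϱ : ℝ) : ℝ :=
  if ν < r then 1
  else ∑ j ∈ Finset.range r, (ν.choose j : ℝ) * (1 - ϱ) ^ j * ϱ ^ (ν - j)

/-- The Taylor–Abel–Poisson mean `A_{ϱ,r}(f)`. -/
def taylorAbelPoisson (r : ℕ) (ϱ : ℝ) (f : ℝ × ℝ → ℂ) (t : ℝ × ℝ) : ℂ :=
  ∑' ν : ℕ, (lam r ν ϱ : ℂ) * ∑ k ∈ J ν, fourierCoeff f k * φ k t

/-- `g` is the radial derivative `f^{[m]}` of order `m` of `f` (both in `L_1(Ω)`); it is determined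
by `f` up to a null set. For `m = 0` the condition says that `g` and `f` have the same Fourier
coefficients, that is `f^{[0]} = f`. -/
def IsRadialDeriv (m : ℕ) (f g : ℝ × ℝ → ℂ) : Prop :=
  MemLp f 1 μΩ ∧ MemLp g 1 μΩ ∧
    ∀ k : Fin 3 → ℤ, ∑ j, k j = 0 →
      fourierCoeff g k =
        if maxAbs k < m then 0
        else ((maxAbs k).factorial : ℂ) / ((maxAbs k - m).factorial : ℂ) * fourierCoeff f k

/-- The `K`-functional `K_n(δ, f)_p = inf {‖f - h‖_p + δ^n ‖h^{[n]}‖_p : h^{[n]} ∈ L_p(Ω)}`; in the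
code `d` is the radial derivative `h^{[n]}`. -/
def KFunctional (n : ℕ) (δ : ℝ) (f : ℝ × ℝ → ℂ) (p : ℝ≥0∞) : ℝ≥0∞ :=
  ⨅ (h : ℝ × ℝ → ℂ) (d : ℝ × ℝ → ℂ) (_ : IsRadialDeriv n h d) (_ : MemLp d p μΩ),
    eLpNorm (f - h) p μΩ + ENNReal.ofReal (δ ^ n) * eLpNorm d p μΩ

/-- The Bari–Stechkin class `𝒵`: continuous strictly increasing `ω` on `[0,1]` with `ω(0) = 0`
and `∫_0^δ ω(t)/t dt = O(ω(δ))` as `δ → 0+`, the integral being finite. -/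
structure BariStechkin (ω : ℝ → ℝ) : Prop where
  continuousOn : ContinuousOn ω (Icc 0 1)
  strictMonoOn : StrictMonoOn ω (Icc 0 1)
  map_zero : ω 0 = 0
  integrableOn : IntegrableOn (fun t => ω t / t) (Ioc 0 1)
  isBigO : (fun δ => ∫ t in (0 : ℝ)..δ, ω t / t) =O[𝓝[>] 0] ω

end Hexagon

end

namespace Hexagon

/-! Let H_ν(f) be the part of the Fourier series of f on |k| = ν, and view F(z) = ∑ z^ν H_ν(f) as an
L_p-valued analytic function on the unit disc. For ν ≥ r the number λ_{ν,r}(ϱ) is the Taylor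
polynomial of x^ν of degree r - 1 about ϱ, evaluated at x = 1, so f - A_{ϱ,r}(f) is formally the
integral remainder (1/(r-1)!) ∫_ϱ^1 (1-x)^{r-1} F^{(r)}(x) dx (`one_sub_lam`,
`norm_tsum_one_sub_lam_le`). If (1-x)^n ‖F^{(r)}(x)‖ is bounded by a multiple of K_n(1-x,
f^{[r-n]}), the integrand is at most a constant times (1-ϱ)^{r-n} ω(1-x)/(1-x), and the
Bari–Stechkin condition finishes the proof.

For the derivative bound (`exists_norm_powSum_derivCoeff_le`) put m = r - n, g = f^{[m]} and split g
= (g - h) + h with h almost optimal for the K-functional. The part with g - h is an n-th derivative,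
and Cauchy's estimate on a circle of radius (1-x)/2 costs (1-x)^{-n}. The part with h has the
coefficients of h^{[n]} up to harmless multipliers (`norm_powSum_descFactorial_le`).

Both parts need the operators f ↦ F(z) to be bounded on L_p uniformly for complex z in a disc of
radius (1-x)/2 about x (`eLpNorm_poisson_le`). This holds because the hexagonal Poisson kernel has a
closed form that is nonnegative for real z = x and dominates the kernel at nearby complex z
(`exists_poissonKernel_dominated`).

The formal remainder is made rigorous by an Abel factor y^ν and the limit y → 1-
(`eLpNorm_sub_multiplierSum_le`), which rests on Abel summability in L_1. -/

/-! ### Monomials and the hexagonal shells |k| = ν. -/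

theorem φ_apply (k : Fin 3 → ℤ) (t : ℝ × ℝ) :
    φ k t = Complex.exp (((2 * Real.pi / 3 * ∑ j, (k j : ℝ) * coord t j : ℝ) : ℂ) * Complex.I) := by
  rw [φ]
  congr 1
  push_cast
  ring

theorem norm_φ (k : Fin 3 → ℤ) (t : ℝ × ℝ) : ‖φ k t‖ = 1 := by
  rw [φ_apply, Complex.norm_exp_ofReal_mul_I]

theorem φ_ne_zero (k : Fin 3 → ℤ) (t : ℝ × ℝ) : φ k t ≠ 0 := Complex.exp_ne_zero _

theorem φ_add (k l : Fin 3 → ℤ) (t : ℝ × ℝ) : φ (k + l) t = φ k t * φ l t := by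
  simp only [φ, ← Complex.exp_add, Fin.sum_univ_three, Pi.add_apply, Int.cast_add]
  congr 1
  ring

theorem φ_zero (t : ℝ × ℝ) : φ 0 t = 1 := by simp [φ]

theorem φ_neg (k : Fin 3 → ℤ) (t : ℝ × ℝ) : φ (-k) t = (φ k t)⁻¹ := by
  refine eq_inv_of_mul_eq_one_left ?_
  rw [← φ_add, neg_add_cancel, φ_zero]

theorem conj_φ (k : Fin 3 → ℤ) (t : ℝ × ℝ) : (starRingEnd ℂ) (φ k t) = φ (-k) t := by
  rw [φ_neg, Complex.inv_def, Complex.normSq_eq_norm_sq, norm_φ]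
  simp

theorem φ_nsmul (n : ℕ) (k : Fin 3 → ℤ) (t : ℝ × ℝ) : φ (n • k) t = φ k t ^ n := by
  induction n with
  | zero => simp [φ_zero]
  | succ n ih => rw [succ_nsmul, φ_add, ih, pow_succ]

theorem φ_sub_right (k : Fin 3 → ℤ) (t s : ℝ × ℝ) :
    φ k (t - s) = φ k t * (starRingEnd ℂ) (φ k s) := by
  rw [conj_φ]
  simp only [φ, ← Complex.exp_add, Fin.sum_univ_three, coord]
  congr 1
  simp
  ring

theorem continuous_φ (k : Fin 3 → ℤ) : Continuous (φ k) := by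
  unfold φ coord
  simp only [Fin.sum_univ_three, Matrix.cons_val_zero, Matrix.cons_val_one, Matrix.cons_val]
  fun_prop

theorem mem_J {ν : ℕ} {k : Fin 3 → ℤ} : k ∈ J ν ↔ ∑ j, k j = 0 ∧ maxAbs k = ν := by
  simp only [J, Finset.mem_filter, Fintype.mem_piFinset, Finset.mem_Icc, and_iff_right_iff_imp]
  rintro ⟨-, h⟩ j
  have : (k j).natAbs ≤ ν := h ▸ Finset.le_sup (f := fun j => (k j).natAbs) (Finset.mem_univ j)
  omega

theorem maxAbs_eq (k : Fin 3 → ℤ) :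
    maxAbs k = max (k 0).natAbs (max (k 1).natAbs (k 2).natAbs) := by
  apply le_antisymm
  · refine Finset.sup_le fun j _ => ?_
    fin_cases j <;> simp
  · have h (j : Fin 3) : (k j).natAbs ≤ maxAbs k :=
      Finset.le_sup (f := fun j => (k j).natAbs) (Finset.mem_univ j)
    exact max_le (h 0) (max_le (h 1) (h 2))

theorem card_J_le (ν : ℕ) : (J ν).card ≤ (2 * ν + 1) ^ 3 := by
  refine (Finset.card_filter_le _ _).trans ?_
  simp only [Fintype.card_piFinset, Int.card_Icc, Finset.prod_const, Finset.card_univ,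
    Fintype.card_fin]
  gcongr
  omega

theorem J_zero : J 0 = {0} := by
  ext k
  rw [mem_J, maxAbs_eq, Finset.mem_singleton, Fin.sum_univ_three, funext_iff, Fin.forall_fin_succ,
    Fin.forall_fin_two]
  simp
  omega

/-! ### Closed form, positivity and domination of the Poisson kernel. -/

/-- The six vertices of the hexagon `|k| = 1`, in cyclic order. -/
def vertex : Fin 6 → Fin 3 → ℤ :=
  ![![1, -1, 0], ![1, 0, -1], ![0, 1, -1], ![-1, 1, 0], ![-1, 0, 1], ![0, -1, 1]]

-- The shell is the boundary of a hexagon with six sides. Each side runs from ν times one vertex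
-- (included) to ν times the next (excluded), so every point is counted once; the case ν = 0 would
-- give an empty sum. The addition `s + 1` is cyclic in `Fin 6`.
set_option maxHeartbeats 1000000 in
theorem sum_J {M : Type*} [AddCommMonoid M] {ν : ℕ} (hν : ν ≠ 0) (F : (Fin 3 → ℤ) → M) :
    ∑ k ∈ J ν, F k =
      ∑ s, ∑ i ∈ Finset.range ν, F ((ν - i) • vertex s + i • vertex (s + 1)) := by
  rw [← Finset.sum_product']
  symm
  refine Finset.sum_bij (fun x _ => (ν - x.2) • vertex x.1 + x.2 • vertex (x.1 + 1)) ?_ ?_ ?_ ?_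
  · rintro ⟨s, i⟩ hi
    simp only [Finset.mem_product, Finset.mem_univ, Finset.mem_range, true_and] at hi
    rw [mem_J, maxAbs_eq, Fin.sum_univ_three]
    fin_cases s <;> simp [vertex] <;> omega
  · rintro ⟨s, i⟩ hi ⟨s', i'⟩ hi' h
    simp only [Finset.mem_product, Finset.mem_univ, Finset.mem_range, true_and] at hi hi'
    have h0 := congrFun h 0
    have h1 := congrFun h 1
    have h2 := congrFun h 2
    clear h
    fin_cases s <;> fin_cases s' <;> simp [vertex] at h0 h1 h2 ⊢ <;> omega
  · intro k hk
    rw [mem_J, maxAbs_eq, Fin.sum_univ_three] at hk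
    have hext (l : Fin 3 → ℤ) (h0 : l 0 = k 0) (h1 : l 1 = k 1) (h2 : l 2 = k 2) : l = k := by
      ext j; fin_cases j <;> assumption
    simp only [Finset.mem_product, Finset.mem_univ, Finset.mem_range, true_and, exists_prop,
      Prod.exists]
    by_cases c0 : k 0 = ν ∧ k 1 < 0
    · refine ⟨0, (k 2).natAbs, by omega, hext _ ?_ ?_ ?_⟩ <;>
        simp [vertex, -Nat.cast_natAbs] <;> omega
    by_cases c1 : k 2 = -ν ∧ 0 < k 0
    · refine ⟨1, (k 1).natAbs, by omega, hext _ ?_ ?_ ?_⟩ <;>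
        simp [vertex, -Nat.cast_natAbs] <;> omega
    by_cases c2 : k 1 = ν ∧ k 2 < 0
    · refine ⟨2, (k 0).natAbs, by omega, hext _ ?_ ?_ ?_⟩ <;>
        simp [vertex, -Nat.cast_natAbs] <;> omega
    by_cases c3 : k 0 = -ν ∧ 0 < k 1
    · refine ⟨3, (k 2).natAbs, by omega, hext _ ?_ ?_ ?_⟩ <;>
        simp [vertex, -Nat.cast_natAbs] <;> omega
    by_cases c4 : k 2 = ν ∧ k 0 < 0
    · refine ⟨4, (k 1).natAbs, by omega, hext _ ?_ ?_ ?_⟩ <;>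
        simp [vertex, -Nat.cast_natAbs] <;> omega
    · refine ⟨5, (k 0).natAbs, by omega, hext _ ?_ ?_ ?_⟩ <;>
        simp [vertex, -Nat.cast_natAbs] <;> omega
  · exact fun _ _ => rfl

/-- The hexagonal Poisson kernel `∑ z ^ |k| φ_k`. -/
noncomputable def poissonKernel (z : ℂ) (t : ℝ × ℝ) : ℂ := ∑' ν : ℕ, z ^ ν * ∑ k ∈ J ν, φ k t

/-- One side of all shells together fills a sector, and its generating function is a Cauchy product
of two geometric series. The extra factor z w reflects that only one of the two bounding rays
belongs to the sector. -/
theorem hasSum_sector {z w w' : ℂ} (hz : ‖z‖ < 1) (hw : ‖w‖ = 1) (hw' : ‖w'‖ = 1) :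
    HasSum (fun ν : ℕ => z ^ ν * ∑ i ∈ Finset.range ν, w ^ (ν - i) * w' ^ i)
      (z * w / ((1 - z * w) * (1 - z * w'))) := by
  have h1 : ‖z * w‖ < 1 := by simpa [hw] using hz
  have h2 : ‖z * w'‖ < 1 := by simpa [hw'] using hz
  have h := hasSum_sum_range_mul_of_summable_norm
    (summable_norm_geometric_of_norm_lt_one h2) (summable_norm_geometric_of_norm_lt_one h1)
  rw [tsum_geometric_of_norm_lt_one h1, tsum_geometric_of_norm_lt_one h2] at h
  have h3 := h.mul_left (z * w)
  rw [← hasSum_nat_add_iff' 1]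
  have e : (fun n : ℕ => z ^ (n + 1) * ∑ i ∈ Finset.range (n + 1), w ^ (n + 1 - i) * w' ^ i) =
      fun n => z * w * ∑ k ∈ Finset.range (n + 1), (z * w') ^ k * (z * w) ^ (n - k) := by
    ext n
    rw [Finset.mul_sum, Finset.mul_sum]
    refine Finset.sum_congr rfl fun i hi => ?_
    obtain ⟨j, rfl⟩ := Nat.exists_eq_add_of_le (Nat.lt_succ_iff.mp (Finset.mem_range.mp hi))
    rw [show i + j + 1 - i = j + 1 by omega, show i + j - i = j by omega]
    ring
  rw [e]
  have e' : z * w / ((1 - z * w) * (1 - z * w')) -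
      ∑ i ∈ Finset.range 1, z ^ i * ∑ j ∈ Finset.range i, w ^ (i - j) * w' ^ j =
      z * w * ((1 - z * w')⁻¹ * (1 - z * w)⁻¹) := by
    simp [div_eq_mul_inv]
  rw [e']
  exact h3

theorem norm_one_sub_ne_zero {z w : ℂ} (hz : ‖z‖ < 1) (hw : ‖w‖ = 1) : 1 - z * w ≠ 0 := by
  intro h
  have : ‖z * w‖ = 1 := by rw [← sub_eq_zero.mp h, norm_one]
  rw [norm_mul, hw, mul_one] at this
  exact hz.ne this

theorem hasSum_poissonKernel {z : ℂ} (hz : ‖z‖ < 1) (t : ℝ × ℝ) :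
    HasSum (fun ν : ℕ => z ^ ν * ∑ k ∈ J ν, φ k t)
      (1 + ∑ s, z * φ (vertex s) t / ((1 - z * φ (vertex s) t) * (1 - z * φ (vertex (s + 1)) t)))
    := by
  have h := hasSum_sum (s := Finset.univ) fun s _ =>
    hasSum_sector hz (norm_φ (vertex s) t) (norm_φ (vertex (s + 1)) t)
  have h0 := (hasSum_ite_eq (0 : ℕ) (1 : ℂ)).add h
  convert h0 using 1
  ext ν
  rcases eq_or_ne ν 0 with rfl | hν
  · simp [J_zero, φ_zero]
  · rw [sum_J hν, if_neg hν, zero_add, Finset.mul_sum]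
    simp_rw [φ_add, φ_nsmul]

/-- The six sectors are regrouped so that each denominator is a product of conjugate pairs (1 -
zw)(1 - z/w). For real 0 ≤ z < 1 and |w| = 1 these are squared moduli and all numerators are
nonnegative, which makes positivity visible. -/
theorem rational_kernel_identity {z a b : ℂ} (ha : a ≠ 0) (hb : b ≠ 0)
    (h1 : 1 - z * a ≠ 0) (h2 : 1 - z * b ≠ 0) (h3 : 1 - z * (a * b) ≠ 0)
    (h4 : 1 - z * a⁻¹ ≠ 0) (h5 : 1 - z * b⁻¹ ≠ 0) (h6 : 1 - z * (a * b)⁻¹ ≠ 0) :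
    1 + (z * a / ((1 - z * a) * (1 - z * (a * b))) + z * (a * b) / ((1 - z * (a * b)) * (1 - z * b))
      + z * b / ((1 - z * b) * (1 - z * a⁻¹)) + z * a⁻¹ / ((1 - z * a⁻¹) * (1 - z * (a * b)⁻¹))
      + z * (a * b)⁻¹ / ((1 - z * (a * b)⁻¹) * (1 - z * b⁻¹))
      + z * b⁻¹ / ((1 - z * b⁻¹) * (1 - z * a))) =
    (1 - z) ^ 3 * (1 - z ^ 3) / (((1 - z * a) * (1 - z * a⁻¹)) * ((1 - z * b) * (1 - z * b⁻¹)) *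
        ((1 - z * (a * b)) * (1 - z * (a * b)⁻¹)))
      + z * (1 - z) ^ 2 * (1 / (((1 - z * a) * (1 - z * a⁻¹)) * ((1 - z * b) * (1 - z * b⁻¹)))
        + 1 / (((1 - z * b) * (1 - z * b⁻¹)) * ((1 - z * (a * b)) * (1 - z * (a * b)⁻¹)))
        + 1 / (((1 - z * a) * (1 - z * a⁻¹)) * ((1 - z * (a * b)) * (1 - z * (a * b)⁻¹)))) := by
  have e4 : 1 - z * a⁻¹ = (a - z) / a := by field_simp
  have e5 : 1 - z * b⁻¹ = (b - z) / b := by field_simp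
  have e6 : 1 - z * (a * b)⁻¹ = (a * b - z) / (a * b) := by field_simp
  rw [e4] at h4 ⊢
  rw [e5] at h5 ⊢
  rw [e6] at h6 ⊢
  have h4' : a - z ≠ 0 := fun h => h4 (by simp [h])
  have h5' : b - z ≠ 0 := fun h => h5 (by simp [h])
  have h6' : a * b - z ≠ 0 := fun h => h6 (by simp [h])
  have h3' : 1 - z * a * b ≠ 0 := by rwa [mul_assoc]
  rw [← mul_assoc z a b]
  clear h4 h5 h6 h3 e4 e5 e6
  field_simp
  ring

/-- `(1 - z w)(1 - z / w)`, which is `|1 - z w|²` for real `z` and `|w| = 1`. -/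
noncomputable def quad (z w : ℂ) : ℂ := (1 - z * w) * (1 - z * w⁻¹)

theorem quad_ofReal {w : ℂ} (hw : ‖w‖ = 1) (x : ℝ) : quad x w = ((‖1 - x * w‖ ^ 2 : ℝ) : ℂ) := by
  have : w⁻¹ = (starRingEnd ℂ) w := by
    rw [Complex.inv_def, Complex.normSq_eq_norm_sq, hw]; simp
  rw [quad, this, Complex.ofReal_pow, ← Complex.mul_conj']
  simp

theorem exists_poissonKernel_eq (t : ℝ × ℝ) :
    ∃ a b c : ℂ, ‖a‖ = 1 ∧ ‖b‖ = 1 ∧ ‖c‖ = 1 ∧ ∀ z : ℂ, ‖z‖ < 1 → poissonKernel z t =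
      (1 - z) ^ 3 * (1 - z ^ 3) / (quad z a * quad z b * quad z c)
      + z * (1 - z) ^ 2 * (1 / (quad z a * quad z b) + 1 / (quad z b * quad z c)
        + 1 / (quad z a * quad z c)) := by
  refine ⟨φ (vertex 0) t, φ (vertex 2) t, φ (vertex 0) t * φ (vertex 2) t, norm_φ _ _, norm_φ _ _,
    by simp [norm_φ], fun z hz => ?_⟩
  have v1 : φ (vertex 1) t = φ (vertex 0) t * φ (vertex 2) t := by
    rw [← φ_add]; congr 1; decide
  have v3 : φ (vertex 3) t = (φ (vertex 0) t)⁻¹ := by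
    rw [← φ_neg]; congr 1; decide
  have v4 : φ (vertex 4) t = (φ (vertex 0) t * φ (vertex 2) t)⁻¹ := by
    rw [← φ_add, ← φ_neg]; congr 1; decide
  have v5 : φ (vertex 5) t = (φ (vertex 2) t)⁻¹ := by
    rw [← φ_neg]; congr 1; decide
  have ha := norm_φ (vertex 0) t
  have hb := norm_φ (vertex 2) t
  unfold quad
  rw [← rational_kernel_identity (φ_ne_zero _ _) (φ_ne_zero _ _), poissonKernel,
    (hasSum_poissonKernel hz t).tsum_eq]
  · simp only [Fin.sum_univ_six, Fin.isValue, Fin.reduceAdd, zero_add, v1, v3, v4, v5]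
  all_goals exact norm_one_sub_ne_zero hz (by simp [ha, hb])

/-- Since |1 - xv| ≥ 1 - x for |v| = 1, moving x by at most (1 - x)/2 can at most halve |1 - xv|. -/
theorem norm_quad_ge {x : ℝ} {z w : ℂ} (hw : ‖w‖ = 1) (hx0 : 0 ≤ x)
    (hz : ‖z - x‖ ≤ (1 - x) / 2) : ‖1 - x * w‖ ^ 2 / 4 ≤ ‖quad z w‖ := by
  have key (v : ℂ) (hv : ‖v‖ = 1) : ‖1 - x * v‖ / 2 ≤ ‖1 - z * v‖ := by
    have h1 : ‖(1 : ℂ) - x * v‖ ≤ ‖1 - z * v‖ + ‖z - x‖ := by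
      have : (1 : ℂ) - x * v = (1 - z * v) + (z - x) * v := by ring
      rw [this]
      refine (norm_add_le _ _).trans ?_
      rw [norm_mul (z - x), hv, mul_one]
    have h2 : 1 - x ≤ ‖(1 : ℂ) - x * v‖ := by
      have := norm_sub_norm_le (1 : ℂ) (x * v)
      rwa [norm_one, norm_mul, hv, mul_one, Complex.norm_real, Real.norm_of_nonneg hx0] at this
    linarith
  have e : ‖(1 : ℂ) - x * w⁻¹‖ = ‖1 - x * w‖ := by
    have : (1 : ℂ) - x * w⁻¹ = (starRingEnd ℂ) (1 - x * w) := by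
      rw [Complex.inv_def, Complex.normSq_eq_norm_sq, hw]; simp
    rw [this, Complex.norm_conj]
  have h1 := key w hw
  have h2 := key w⁻¹ (by simp [hw])
  rw [e] at h2
  rw [quad, norm_mul]
  calc ‖1 - x * w‖ ^ 2 / 4 = (‖1 - x * w‖ / 2) * (‖1 - x * w‖ / 2) := by ring
    _ ≤ _ := by gcongr

theorem norm_lt_one_of_near {x : ℝ} {z : ℂ} (hx0 : 0 ≤ x) (hx1 : x < 1)
    (hz : ‖z - x‖ ≤ (1 - x) / 2) : ‖z‖ < 1 := by
  have := norm_le_norm_add_norm_sub (x : ℂ) z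
  rw [Complex.norm_real, Real.norm_of_nonneg hx0, norm_sub_rev] at this
  linarith

/-- In the closed form every numerator factor at z is at most a constant times its value at x, and
every denominator factor is at least a constant times its value at x. Comparing the two nonnegative
terms separately gives the domination. -/
theorem exists_poissonKernel_dominated (t : ℝ × ℝ) {x : ℝ} (hx0 : 0 ≤ x) (hx1 : x < 1) :
    ∃ κ : ℝ, 0 ≤ κ ∧ poissonKernel x t = κ ∧
      (1 / 2 ≤ x → ∀ z : ℂ, ‖z - x‖ ≤ (1 - x) / 2 → ‖poissonKernel z t‖ ≤ 1000 * κ) := by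
  obtain ⟨a, b, c, ha, hb, hc, h⟩ := exists_poissonKernel_eq t
  have hxn : ‖(x : ℂ)‖ < 1 := by rwa [Complex.norm_real, Real.norm_of_nonneg hx0]
  have pos (w : ℂ) (hw : ‖w‖ = 1) : 0 < ‖1 - x * w‖ ^ 2 := by
    have := norm_pos_iff.mpr (norm_one_sub_ne_zero hxn hw)
    positivity
  have pa := pos a ha
  have pb := pos b hb
  have pc := pos c hc
  have qa := fun (z : ℂ) (hz : ‖z - x‖ ≤ (1 - x) / 2) => norm_quad_ge (z := z) ha hx0 hz
  have qb := fun (z : ℂ) (hz : ‖z - x‖ ≤ (1 - x) / 2) => norm_quad_ge (z := z) hb hx0 hz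
  have qc := fun (z : ℂ) (hz : ‖z - x‖ ≤ (1 - x) / 2) => norm_quad_ge (z := z) hc hx0 hz
  have ea := quad_ofReal ha x
  have eb := quad_ofReal hb x
  have ec := quad_ofReal hc x
  generalize ‖1 - x * a‖ ^ 2 = A at *
  generalize ‖1 - x * b‖ ^ 2 = B at *
  generalize ‖1 - x * c‖ ^ 2 = C at *
  have h3 : 1 - x ≤ 1 - x ^ 3 := by nlinarith [mul_nonneg hx0 (sub_nonneg.mpr hx1.le)]
  have hx1' : 0 < 1 - x := by linarith
  refine ⟨(1 - x) ^ 3 * (1 - x ^ 3) / (A * B * C) + x * (1 - x) ^ 2 * (1 / (A * B) + 1 / (B * C)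
    + 1 / (A * C)), ?_, ?_, ?_⟩
  · have : 0 ≤ 1 - x ^ 3 := by linarith
    positivity
  · rw [h x hxn, ea, eb, ec]
    push_cast
    ring
  · intro hx2 z hz
    have hz1 : ‖z‖ < 1 := norm_lt_one_of_near hx0 hx1 hz
    rw [h z hz1]
    have n1 : ‖1 - z‖ ≤ 3 / 2 * (1 - x) := by
      have : (1 : ℂ) - z = ((1 - x : ℝ) : ℂ) - (z - x) := by push_cast; ring
      rw [this]
      refine (norm_sub_le _ _).trans ?_
      rw [Complex.norm_real, Real.norm_of_nonneg hx1'.le]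
      linarith
    have n3 : ‖1 - z ^ 3‖ ≤ 9 / 2 * (1 - x ^ 3) := by
      have e : (1 : ℂ) - z ^ 3 = (1 - z) * (1 + z + z ^ 2) := by ring
      have : ‖1 + z + z ^ 2‖ ≤ 3 := by
        refine (norm_add₃_le).trans ?_
        rw [norm_one, norm_pow]
        nlinarith [norm_nonneg z]
      rw [e, norm_mul]
      calc ‖1 - z‖ * ‖1 + z + z ^ 2‖ ≤ (3 / 2 * (1 - x)) * 3 := by gcongr
        _ ≤ _ := by linarith
    -- The bound 1/2 ≤ x enters here: |z| < 1 ≤ 2x controls the factor z of the second term.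
    have hzx : ‖z‖ ≤ 2 * x := by linarith
    have hx3 : 0 ≤ 1 - x ^ 3 := by linarith
    have T1 : ‖(1 - z) ^ 3 * (1 - z ^ 3) / (quad z a * quad z b * quad z c)‖ ≤
        (3 / 2 * (1 - x)) ^ 3 * (9 / 2 * (1 - x ^ 3)) / (A / 4 * (B / 4) * (C / 4)) := by
      rw [norm_div, norm_mul, norm_mul, norm_mul, norm_pow]
      gcongr
      all_goals first | exact qa z hz | exact qb z hz | exact qc z hz
    have T2 : ‖z * (1 - z) ^ 2 * (1 / (quad z a * quad z b) + 1 / (quad z b * quad z c)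
        + 1 / (quad z a * quad z c))‖ ≤ 2 * x * (3 / 2 * (1 - x)) ^ 2 *
        (1 / (A / 4 * (B / 4)) + 1 / (B / 4 * (C / 4)) + 1 / (A / 4 * (C / 4))) := by
      rw [norm_mul, norm_mul, norm_pow]
      have : ‖1 / (quad z a * quad z b) + 1 / (quad z b * quad z c) + 1 / (quad z a * quad z c)‖ ≤
          1 / (A / 4 * (B / 4)) + 1 / (B / 4 * (C / 4)) + 1 / (A / 4 * (C / 4)) := by
        refine (norm_add₃_le).trans ?_
        rw [norm_div, norm_div, norm_div, norm_mul, norm_mul, norm_mul, norm_one]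
        gcongr
        exacts [qa z hz, qb z hz, qb z hz, qc z hz, qa z hz, qc z hz]
      gcongr
    refine (norm_add_le _ _).trans ((add_le_add T1 T2).trans ?_)
    -- The two terms lose the factors 972 and 72, both below 1000.
    have e1 : (3 / 2 * (1 - x)) ^ 3 * (9 / 2 * (1 - x ^ 3)) / (A / 4 * (B / 4) * (C / 4)) =
        972 * ((1 - x) ^ 3 * (1 - x ^ 3) / (A * B * C)) := by
      field_simp
      ring
    have e2 : 2 * x * (3 / 2 * (1 - x)) ^ 2 *
        (1 / (A / 4 * (B / 4)) + 1 / (B / 4 * (C / 4)) + 1 / (A / 4 * (C / 4))) =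
        72 * (x * (1 - x) ^ 2 * (1 / (A * B) + 1 / (B * C) + 1 / (A * C))) := by
      field_simp
      ring
    rw [e1, e2]
    have p1 : 0 ≤ (1 - x) ^ 3 * (1 - x ^ 3) / (A * B * C) := by positivity
    have p2 : 0 ≤ x * (1 - x) ^ 2 * (1 / (A * B) + 1 / (B * C) + 1 / (A * C)) := by positivity
    linarith

/-! ### Geometry of the hexagon and orthogonality of the monomials. -/

theorem mem_Ω {t : ℝ × ℝ} : t ∈ Ω ↔
    (-1 ≤ t.1 ∧ t.1 < 1) ∧ (-1 ≤ t.2 ∧ t.2 < 1) ∧ -1 < t.1 + t.2 ∧ t.1 + t.2 ≤ 1 := by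
  simp only [Ω, coord, mem_ofPred_eq, Fin.forall_fin_succ, Matrix.cons_val_zero,
    Matrix.cons_val_succ, IsEmpty.forall_iff, and_true]
  constructor
  · rintro ⟨h1, h2, h3⟩
    exact ⟨h1, h2, by linarith, by linarith⟩
  · rintro ⟨h1, h2, h3⟩
    exact ⟨h1, h2, by linarith, by linarith⟩

theorem measurableSet_Ω : MeasurableSet Ω := by
  have : Ω = {t : ℝ × ℝ | (-1 ≤ t.1 ∧ t.1 < 1) ∧ (-1 ≤ t.2 ∧ t.2 < 1) ∧
      -1 < t.1 + t.2 ∧ t.1 + t.2 ≤ 1} := by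
    ext t
    exact mem_Ω
  rw [this]
  measurability

theorem volume_Ω_lt_top : volume Ω < ⊤ := by
  refine (measure_mono fun t ht => ?_).trans_lt
    (isCompact_Icc (a := ((-1, -1) : ℝ × ℝ)) (b := (1, 1))).measure_lt_top
  obtain ⟨h1, h2, -⟩ := mem_Ω.mp ht
  exact ⟨⟨h1.1, h2.1⟩, ⟨h1.2.le, h2.2.le⟩⟩

theorem ae_ne_fst (c : ℝ) : ∀ᵐ t : ℝ × ℝ, t.1 ≠ c := by
  have h : volume ({c} ×ˢ univ : Set (ℝ × ℝ)) = 0 := by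
    rw [Measure.volume_eq_prod, Measure.prod_prod]
    simp
  filter_upwards [compl_mem_ae_iff.mpr h] with t ht h'
  exact ht (by simp [h'])

theorem ae_ne_snd (c : ℝ) : ∀ᵐ t : ℝ × ℝ, t.2 ≠ c := by
  have h : volume (univ ×ˢ {c} : Set (ℝ × ℝ)) = 0 := by
    rw [Measure.volume_eq_prod, Measure.prod_prod]
    simp
  filter_upwards [compl_mem_ae_iff.mpr h] with t ht h'
  exact ht (by simp [h'])

theorem measurePreserving_fst_add :
    MeasurePreserving (fun t : ℝ × ℝ => (t.1, t.1 + t.2)) volume volume :=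
  measurePreserving_prod_add volume volume

theorem measurePreserving_snd_add :
    MeasurePreserving (fun t : ℝ × ℝ => (t.2, t.2 + t.1)) volume volume :=
  measurePreserving_prod_add_swap volume volume

/-- The three parallelograms into which the hexagon is cut. -/
def para : Fin 3 → Set (ℝ × ℝ) :=
  ![(fun t : ℝ × ℝ => (t.1, t.1 + t.2)) ⁻¹' (Ico 0 1 ×ˢ Ico 0 1), Ioo (-1) 0 ×ˢ Ico 0 1,
    (fun t : ℝ × ℝ => (t.2, t.2 + t.1)) ⁻¹' (Ioo (-1) 0 ×ˢ Ioo (-1) 0)]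

theorem measurableSet_para (i : Fin 3) : MeasurableSet (para i) := by
  fin_cases i
  · exact (measurableSet_Ico.prod measurableSet_Ico).preimage measurePreserving_fst_add.measurable
  · exact measurableSet_Ioo.prod measurableSet_Ico
  · exact (measurableSet_Ioo.prod measurableSet_Ioo).preimage measurePreserving_snd_add.measurable

theorem Ω_ae_eq : Ω =ᵐ[volume] ⋃ i, para i := by
  -- Only the edges t₁ = -1, t₂ = -1 and t₁ + t₂ = 1 are lost, and they are null sets.
  filter_upwards [ae_ne_fst (-1), ae_ne_snd (-1),
    measurePreserving_fst_add.quasiMeasurePreserving.ae (ae_ne_snd 1)] with t h1 h2 h3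
  rw [eq_iff_iff]
  change t ∈ Ω ↔ t ∈ ⋃ i, para i
  rw [mem_Ω, mem_iUnion, Fin.exists_fin_succ, Fin.exists_fin_two]
  simp only [para, Matrix.cons_val_zero, Matrix.cons_val_succ, Matrix.cons_val_one, mem_preimage,
    mem_prod, mem_Ico, mem_Ioo]
  constructor
  · rintro ⟨⟨a1, a2⟩, ⟨b1, b2⟩, c1, c2⟩
    have a1' := lt_of_le_of_ne a1 (Ne.symm h1)
    have b1' := lt_of_le_of_ne b1 (Ne.symm h2)
    have c2' := lt_of_le_of_ne c2 h3
    rcases lt_or_ge (t.1 + t.2) 0 with hs | hs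
    · rcases lt_or_ge t.2 0 with ht | ht
      · exact Or.inr (Or.inr ⟨⟨b1', ht⟩, by linarith, by linarith⟩)
      · exact Or.inr (Or.inl ⟨⟨a1', by linarith⟩, ht, b2⟩)
    · rcases lt_or_ge t.1 0 with ht | ht
      · exact Or.inr (Or.inl ⟨⟨a1', ht⟩, by linarith, b2⟩)
      · exact Or.inl ⟨⟨ht, a2⟩, hs, c2'⟩
  · rintro (⟨⟨a, b⟩, c, d⟩ | ⟨⟨a, b⟩, c, d⟩ | ⟨⟨a, b⟩, c, d⟩) <;>
    refine ⟨⟨?_, ?_⟩, ⟨?_, ?_⟩, ?_, ?_⟩ <;> linarith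

theorem pairwise_disjoint_para : Pairwise (Function.onFun Disjoint para) := by
  intro i j hij
  rw [Function.onFun, Set.disjoint_left]
  intro t
  fin_cases i <;> fin_cases j <;>
    simp [para] at hij ⊢ <;> intros <;> linarith

/-- The mean of `exp (2πi m a / 3)` over the unit interval. -/
noncomputable def edgeMean (m : ℤ) : ℂ :=
  ∫ a in (0 : ℝ)..1, Complex.exp (2 * Real.pi * Complex.I / 3 * m * a)

theorem setIntegral_Ico_exp (m : ℤ) :
    ∫ a in Ico (0 : ℝ) 1, Complex.exp (2 * Real.pi * Complex.I / 3 * m * a) = edgeMean m := by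
  rw [integral_Ico_eq_integral_Ioc, edgeMean, intervalIntegral.integral_of_le zero_le_one]

theorem setIntegral_Ioo_exp (m : ℤ) :
    ∫ a in Ioo (-1 : ℝ) 0, Complex.exp (2 * Real.pi * Complex.I / 3 * m * a) = edgeMean (-m) := by
  rw [← integral_Ioc_eq_integral_Ioo, ← intervalIntegral.integral_of_le (by norm_num), edgeMean]
  have := intervalIntegral.integral_comp_neg (a := 0) (b := 1)
    fun a : ℝ => Complex.exp (2 * Real.pi * Complex.I / 3 * m * a)
  rw [neg_zero] at this
  rw [← this]
  congr 1
  ext a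
  push_cast
  ring_nf

theorem integrableOn_φ (k : Fin 3 → ℤ) : IntegrableOn (φ k) Ω :=
  Measure.integrableOn_of_bounded (M := 1) volume_Ω_lt_top.ne
    (continuous_φ k).aestronglyMeasurable (by simp [norm_φ])

/-- Each parallelogram becomes a product of unit intervals, two of them after a measure-preserving
shear, so the integral of an exponential factors over it. -/
theorem setIntegral_φ (k : Fin 3 → ℤ) : ∫ t in Ω, φ k t =
    edgeMean (k 0 - k 1) * edgeMean (k 1 - k 2) + edgeMean (k 2 - k 0) * edgeMean (k 1 - k 2)
      + edgeMean (k 0 - k 1) * edgeMean (k 2 - k 0) := by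
  have hint : IntegrableOn (φ k) (⋃ i, para i) := (integrableOn_φ k).congr_set_ae Ω_ae_eq.symm
  rw [setIntegral_congr_set Ω_ae_eq, integral_iUnion measurableSet_para pairwise_disjoint_para hint,
    tsum_fintype, Fin.sum_univ_three]
  have prod (m l : ℤ) (A B : Set ℝ) : ∫ z in A ×ˢ B,
      Complex.exp (2 * Real.pi * Complex.I / 3 * m * (z.1 : ℝ)) *
      Complex.exp (2 * Real.pi * Complex.I / 3 * l * (z.2 : ℝ)) =
      (∫ a in A, Complex.exp (2 * Real.pi * Complex.I / 3 * m * a)) *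
      ∫ b in B, Complex.exp (2 * Real.pi * Complex.I / 3 * l * b) := by
    rw [Measure.volume_eq_prod]
    exact setIntegral_prod_mul (μ := volume) (ν := volume)
      (fun a : ℝ => Complex.exp (2 * Real.pi * Complex.I / 3 * m * a))
      (fun b : ℝ => Complex.exp (2 * Real.pi * Complex.I / 3 * l * b)) A B
  have e1 : ∫ t in para 0, φ k t = edgeMean (k 0 - k 1) * edgeMean (k 1 - k 2) := by
    rw [← setIntegral_Ico_exp, ← setIntegral_Ico_exp, ← prod,
      ← measurePreserving_fst_add.setIntegral_preimage_emb
        (MeasurableEquiv.shearAddRight ℝ).measurableEmbedding _ (Ico 0 1 ×ˢ Ico 0 1)]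
    refine integral_congr_ae (.of_forall fun t => ?_)
    simp only [φ, ← Complex.exp_add, Fin.sum_univ_three, coord]
    congr 1
    simp
    ring
  have e2 : ∫ t in para 1, φ k t = edgeMean (k 2 - k 0) * edgeMean (k 1 - k 2) := by
    rw [← neg_sub (k 0), ← setIntegral_Ioo_exp, ← setIntegral_Ico_exp, ← prod]
    refine integral_congr_ae (.of_forall fun t => ?_)
    simp only [φ, ← Complex.exp_add, Fin.sum_univ_three, coord]
    congr 1
    simp
    ring
  have e3 : ∫ t in para 2, φ k t = edgeMean (k 0 - k 1) * edgeMean (k 2 - k 0) := by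
    rw [← neg_sub (k 0) (k 2), ← neg_sub (k 1), ← setIntegral_Ioo_exp, ← setIntegral_Ioo_exp,
      ← prod, ← measurePreserving_snd_add.setIntegral_preimage_emb
        ((MeasurableEquiv.prodComm.trans (MeasurableEquiv.shearAddRight ℝ)).measurableEmbedding)
        _ (Ioo (-1) 0 ×ˢ Ioo (-1) 0)]
    refine integral_congr_ae (.of_forall fun t => ?_)
    simp only [φ, ← Complex.exp_add, Fin.sum_univ_three, coord]
    congr 1
    simp
    ring
  rw [e1, e2, e3]

theorem edgeMean_zero : edgeMean 0 = 1 := by simp [edgeMean]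

theorem edgeMean_of_ne_zero {m : ℤ} (hm : m ≠ 0) :
    edgeMean m = (Complex.exp (2 * Real.pi * Complex.I / 3 * m) - 1) /
      (2 * Real.pi * Complex.I / 3 * m) := by
  rw [edgeMean, integral_exp_mul_complex]
  · simp
  · simp [hm, Real.pi_ne_zero]

theorem setIntegral_φ_zero : ∫ t in Ω, φ 0 t = 3 := by
  rw [setIntegral_φ]
  simp [edgeMean_zero]
  norm_num

theorem volume_Ω : volume Ω = 3 := by
  have h := setIntegral_φ_zero
  simp only [φ_zero, setIntegral_const, Complex.real_smul, mul_one] at h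
  have h' : volume.real Ω = 3 := by exact_mod_cast h
  rw [← ofReal_measureReal volume_Ω_lt_top.ne, h']
  simp

instance : IsProbabilityMeasure μΩ := by
  constructor
  rw [μΩ, Measure.smul_apply, Measure.restrict_apply_univ, smul_eq_mul, volume_Ω]
  exact ENNReal.inv_mul_cancel (by norm_num) (by norm_num)

/-- The differences m₁, m₂, m₃ of the k_j are congruent modulo 3, so the three exponentials share
one value w. If all m_i are nonzero, the sum is a multiple of 1/(m₁m₂) + 1/(m₂m₃) + 1/(m₁m₃), which
vanishes because m₁ + m₂ + m₃ = 0. If one m_i is zero, then w = 1 and the means of the other two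
vanish. -/
theorem setIntegral_φ_of_ne_zero {k : Fin 3 → ℤ} (hk : ∑ j, k j = 0) (h0 : k ≠ 0) :
    ∫ t in Ω, φ k t = 0 := by
  rw [Fin.sum_univ_three] at hk
  have per (m l : ℤ) : Complex.exp (2 * Real.pi * Complex.I / 3 * (m + 3 * l : ℤ)) =
      Complex.exp (2 * Real.pi * Complex.I / 3 * m) := by
    rw [Complex.exp_eq_exp_iff_exists_int]
    refine ⟨l, ?_⟩
    push_cast
    ring
  have p1 := per (k 0 - k 1) (k 1)
  have p2 := per (k 0 - k 1) (- k 0)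
  rw [show k 0 - k 1 + 3 * k 1 = k 1 - k 2 by omega] at p1
  rw [show k 0 - k 1 + 3 * -k 0 = k 2 - k 0 by omega] at p2
  rw [setIntegral_φ]
  have hsum : (k 0 - k 1) + (k 1 - k 2) + (k 2 - k 0) = 0 := by ring
  have hne : k 0 - k 1 ≠ 0 ∨ k 1 - k 2 ≠ 0 := by
    by_contra! h
    apply h0
    ext j
    fin_cases j <;> simp <;> omega
  generalize k 0 - k 1 = m1 at *
  generalize k 1 - k 2 = m2 at *
  generalize k 2 - k 0 = m3 at *
  have key (a b c : ℤ) (hb : b ≠ 0) (hc : c ≠ 0) (ha : a = 0)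
      (hab : Complex.exp (2 * Real.pi * Complex.I / 3 * b) =
        Complex.exp (2 * Real.pi * Complex.I / 3 * a))
      (hac : Complex.exp (2 * Real.pi * Complex.I / 3 * c) =
        Complex.exp (2 * Real.pi * Complex.I / 3 * a)) : edgeMean b = 0 ∧ edgeMean c = 0 := by
    rw [edgeMean_of_ne_zero hb, edgeMean_of_ne_zero hc, hab, hac, ha]
    simp
  by_cases z1 : m1 = 0
  · obtain ⟨h1, h2⟩ := key m1 m2 m3 (by omega) (by omega) z1 p1 p2
    simp [h1, h2]
  by_cases z2 : m2 = 0
  · obtain ⟨h1, h2⟩ := key m2 m1 m3 (by omega) (by omega) z2 p1.symm (p2.trans p1.symm)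
    simp [h1, h2]
  by_cases z3 : m3 = 0
  · obtain ⟨h1, h2⟩ := key m3 m1 m2 (by omega) (by omega) z3 p2.symm (p1.trans p2.symm)
    simp [h1, h2]
  have c3 : (m3 : ℂ) = -m1 - m2 := by
    have : m3 = -m1 - m2 := by omega
    rw [this]; push_cast; ring
  rw [edgeMean_of_ne_zero z1, edgeMean_of_ne_zero z2, edgeMean_of_ne_zero z3, p1, p2]
  have c1 : (m1 : ℂ) ≠ 0 := by exact_mod_cast z1
  have c2 : (m2 : ℂ) ≠ 0 := by exact_mod_cast z2
  have c3' : (m3 : ℂ) ≠ 0 := by exact_mod_cast z3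
  have hq : 2 * Real.pi * Complex.I / 3 ≠ 0 := by simp [Real.pi_ne_zero]
  generalize Complex.exp _ = w
  generalize 2 * Real.pi * Complex.I / 3 = q at *
  rw [c3] at c3' ⊢
  field_simp
  ring

theorem integral_φ {k : Fin 3 → ℤ} (hk : ∑ j, k j = 0) :
    ∫ t, φ k t ∂μΩ = if k = 0 then 1 else 0 := by
  rw [μΩ, integral_smul_measure]
  split_ifs with h
  · rw [h, setIntegral_φ_zero, volume_Ω]
    simp
  · rw [setIntegral_φ_of_ne_zero hk h, smul_zero]

/-! ### Uniform L_p bounds for Poisson sums. -/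

/-- A doubly stochastic kernel contracts L_p: the row condition makes K(t, ·)μ a probability
measure, so its L_1 norm is at most its L_p norm, and Tonelli with the column condition integrates
out t. -/
theorem eLpNorm_le_of_kernel {α : Type*} [MeasurableSpace α] {μ : Measure α} [SFinite μ]
    {K : α → α → ℝ≥0∞} (hK : Measurable (Function.uncurry K)) (h1 : ∀ t, ∫⁻ s, K t s ∂μ = 1)
    (h2 : ∀ s, ∫⁻ t, K t s ∂μ = 1) {f u : α → ℂ} (hf : AEStronglyMeasurable f μ)
    (hu : ∀ t, ‖u t‖ₑ ≤ ∫⁻ s, K t s * ‖f s‖ₑ ∂μ) {p : ℝ≥0∞} (hp : 1 ≤ p) :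
    eLpNorm u p μ ≤ eLpNorm f p μ := by
  have hKt (t : α) : Measurable (K t) := hK.of_uncurry_left
  have hprob (t : α) : IsProbabilityMeasure (μ.withDensity (K t)) :=
    ⟨by rw [withDensity_apply _ MeasurableSet.univ, Measure.restrict_univ, h1]⟩
  have hac (t : α) : μ.withDensity (K t) ≪ μ := withDensity_absolutelyContinuous _ _
  have hmono (t : α) : ‖u t‖ₑ ≤ eLpNorm f p (μ.withDensity (K t)) := by
    refine ((hu t).trans_eq ?_).trans
      (eLpNorm_le_eLpNorm_of_exponent_le hp (hf.mono_ac (hac t)))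
    rw [eLpNorm_one_eq_lintegral_enorm,
      lintegral_withDensity_eq_lintegral_mul₀ (hKt t).aemeasurable hf.enorm]
    rfl
  have hp0 : p ≠ 0 := (zero_lt_one.trans_le hp).ne'
  rcases eq_or_ne p ⊤ with rfl | hp'
  · simp only [eLpNorm_exponent_top] at hmono ⊢
    exact essSup_le_of_ae_le _ (.of_forall fun t =>
      (hmono t).trans (eLpNormEssSup_mono_measure f (hac t)))
  · have hpp : 0 < p.toReal := ENNReal.toReal_pos hp0 hp'
    rw [eLpNorm_eq_lintegral_rpow_enorm_toReal hp0 hp',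
      eLpNorm_eq_lintegral_rpow_enorm_toReal hp0 hp']
    refine ENNReal.rpow_le_rpow ?_ (by positivity)
    calc ∫⁻ t, ‖u t‖ₑ ^ p.toReal ∂μ ≤ ∫⁻ t, ∫⁻ s, K t s * ‖f s‖ₑ ^ p.toReal ∂μ ∂μ := by
          refine lintegral_mono fun t => ?_
          have := hmono t
          rw [eLpNorm_eq_lintegral_rpow_enorm_toReal hp0 hp'] at this
          refine (ENNReal.rpow_le_rpow this hpp.le).trans_eq ?_
          rw [← ENNReal.rpow_mul, one_div_mul_cancel hpp.ne', ENNReal.rpow_one,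
            lintegral_withDensity_eq_lintegral_mul₀ (hKt t).aemeasurable (hf.enorm.pow_const _)]
          rfl
      _ = ∫⁻ s, ∫⁻ t, K t s * ‖f s‖ₑ ^ p.toReal ∂μ ∂μ :=
          lintegral_lintegral_swap
            (hK.aemeasurable.mul ((hf.enorm.pow_const _).comp_snd))
      _ = ∫⁻ s, ‖f s‖ₑ ^ p.toReal ∂μ := by
          refine lintegral_congr fun s => ?_
          rw [lintegral_mul_const _ hK.of_uncurry_right, h2, one_mul]

/-- Polynomial growth of a sequence. -/
def PolyGrowth {E : Type*} [Norm E] (a : ℕ → E) : Prop :=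
  ∃ C : ℝ, ∃ d : ℕ, 0 ≤ C ∧ ∀ ν, ‖a ν‖ ≤ C * ((ν : ℝ) + 1) ^ d

theorem summable_add_one_pow_mul_geometric (d : ℕ) {ρ : ℝ} (h0 : 0 ≤ ρ) (h1 : ρ < 1) :
    Summable fun ν : ℕ => ((ν : ℝ) + 1) ^ d * ρ ^ ν := by
  rcases h0.eq_or_lt with rfl | hpos
  · refine summable_of_ne_finset_zero (s := {0}) fun ν hν => ?_
    simp at hν
    simp [hν]
  have h := summable_pow_mul_geometric_of_norm_lt_one (R := ℝ) d
    (by rwa [Real.norm_of_nonneg h0] : ‖ρ‖ < 1)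
  have h' := ((summable_nat_add_iff 1).mpr h).mul_right ρ⁻¹
  refine h'.congr fun ν => ?_
  push_cast
  rw [pow_succ]
  field_simp

theorem PolyGrowth.summable {E : Type*} [NormedAddCommGroup E] {a : ℕ → E} (ha : PolyGrowth a)
    {ρ : ℝ} (h0 : 0 ≤ ρ) (h1 : ρ < 1) : Summable fun ν => ρ ^ ν * ‖a ν‖ := by
  obtain ⟨C, d, -, h⟩ := ha
  refine Summable.of_nonneg_of_le (fun ν => by positivity) (fun ν => ?_)
    ((summable_add_one_pow_mul_geometric d h0 h1).mul_left C)
  calc ρ ^ ν * ‖a ν‖ ≤ ρ ^ ν * (C * ((ν : ℝ) + 1) ^ d) := by gcongr; exact h ν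
    _ = _ := by ring

theorem PolyGrowth.summable_smul {E : Type*} [NormedAddCommGroup E] [NormedSpace ℂ E]
    [CompleteSpace E] {a : ℕ → E} (ha : PolyGrowth a) {z : ℂ} (hz : ‖z‖ < 1) :
    Summable fun ν => z ^ ν • a ν := by
  refine Summable.of_norm ((ha.summable (norm_nonneg z) hz).congr fun ν => ?_)
  rw [norm_smul, norm_pow]

theorem card_J_le' (ν : ℕ) : ((J ν).card : ℝ) ≤ 8 * ((ν : ℝ) + 1) ^ 3 := by
  have h : ((J ν).card : ℝ) ≤ ((2 * ν + 1 : ℕ) : ℝ) ^ 3 := by exact_mod_cast card_J_le ν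
  refine h.trans ?_
  have : ((2 * ν + 1 : ℕ) : ℝ) ≤ 2 * ((ν : ℝ) + 1) := by push_cast; linarith
  calc ((2 * ν + 1 : ℕ) : ℝ) ^ 3 ≤ (2 * ((ν : ℝ) + 1)) ^ 3 := by gcongr
    _ = _ := by ring

theorem norm_sum_J_le (F : (Fin 3 → ℤ) → ℂ) {C : ℝ} (hF : ∀ k, ‖F k‖ ≤ C) (ν : ℕ) :
    ‖∑ k ∈ J ν, F k‖ ≤ C * 8 * ((ν : ℝ) + 1) ^ 3 := by
  have hC : 0 ≤ C := (norm_nonneg _).trans (hF 0)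
  calc ‖∑ k ∈ J ν, F k‖ ≤ (J ν).card * C := by
        refine (norm_sum_le _ _).trans ((Finset.sum_le_sum fun k _ => hF k).trans_eq ?_)
        rw [Finset.sum_const, nsmul_eq_mul]
    _ ≤ 8 * ((ν : ℝ) + 1) ^ 3 * C := by gcongr; exact card_J_le' ν
    _ = _ := by ring

theorem norm_fourierCoeff_le (f : ℝ × ℝ → ℂ) (k : Fin 3 → ℤ) :
    ‖fourierCoeff f k‖ ≤ ∫ t, ‖f t‖ ∂μΩ := by
  refine (norm_integral_le_integral_norm _).trans_eq ?_
  simp [norm_φ]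

theorem continuous_poissonKernel {z : ℂ} (hz : ‖z‖ < 1) : Continuous (poissonKernel z) := by
  refine continuous_tsum (fun ν => ?_)
    ((summable_add_one_pow_mul_geometric 3 (norm_nonneg z) hz).mul_left 8) fun ν t => ?_
  · exact continuous_const.mul (continuous_finsetSum _ fun k _ => continuous_φ k)
  · rw [norm_mul, norm_pow]
    have := norm_sum_J_le (fun k => φ k t) (C := 1) (fun k => (norm_φ k t).le) ν
    calc ‖z‖ ^ ν * ‖∑ k ∈ J ν, φ k t‖ ≤ ‖z‖ ^ ν * (1 * 8 * ((ν : ℝ) + 1) ^ 3) := by gcongr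
      _ = _ := by ring

theorem neg_mem_J {ν : ℕ} {k : Fin 3 → ℤ} (hk : k ∈ J ν) : -k ∈ J ν := by
  rw [mem_J, maxAbs] at hk ⊢
  simpa using hk

theorem φ_neg_right (k : Fin 3 → ℤ) (t : ℝ × ℝ) : φ k (-t) = φ (-k) t := by
  rw [← zero_sub, φ_sub_right, conj_φ]
  simp [φ, coord, Fin.sum_univ_three]

theorem poissonKernel_neg (z : ℂ) (t : ℝ × ℝ) : poissonKernel z (-t) = poissonKernel z t := by
  unfold poissonKernel
  congr 1
  ext ν
  congr 1
  exact Finset.sum_bij' (fun k _ => -k) (fun k _ => -k) (fun _ => neg_mem_J) (fun _ => neg_mem_J)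
    (by simp) (by simp) (fun k _ => φ_neg_right k t)

theorem hasSum_poisson_integral {f : ℝ × ℝ → ℂ} (hf : MemLp f 1 μΩ) {z : ℂ} (hz : ‖z‖ < 1)
    (t : ℝ × ℝ) : HasSum (fun ν : ℕ => z ^ ν * ∑ k ∈ J ν, fourierCoeff f k * φ k t)
      (∫ s, f s * poissonKernel z (t - s) ∂μΩ) := by
  have hfi := memLp_one_iff_integrable.mp hf
  have hint (ν : ℕ) : Integrable (fun s => f s * (z ^ ν * ∑ k ∈ J ν, φ k (t - s))) μΩ := by
    refine hfi.mul_bdd (c := ‖z‖ ^ ν * (1 * 8 * ((ν : ℝ) + 1) ^ 3))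
      (Continuous.aestronglyMeasurable ?_) (.of_forall fun s => ?_)
    · exact continuous_const.mul (continuous_finsetSum _ fun k _ =>
        (continuous_φ k).comp (continuous_const.sub continuous_id))
    · rw [norm_mul, norm_pow]
      gcongr
      exact norm_sum_J_le (fun k => φ k (t - s)) (C := 1) (fun k => (norm_φ k _).le) ν
  have h := hasSum_integral_of_summable_integral_norm hint ?_
  · have e1 (ν : ℕ) : ∫ s, f s * (z ^ ν * ∑ k ∈ J ν, φ k (t - s)) ∂μΩ =
        z ^ ν * ∑ k ∈ J ν, fourierCoeff f k * φ k t := by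
      simp_rw [mul_left_comm _ (z ^ ν)]
      rw [integral_const_mul]
      congr 1
      simp_rw [Finset.mul_sum]
      rw [integral_finsetSum]
      · refine Finset.sum_congr rfl fun k _ => ?_
        rw [fourierCoeff, ← integral_mul_const]
        congr 1
        ext s
        rw [φ_sub_right]
        ring
      · intro k _
        exact hfi.mul_bdd (c := 1) ((continuous_φ k).comp
          (continuous_const.sub continuous_id)).aestronglyMeasurable
          (.of_forall fun s => (norm_φ k _).le)
    have e2 (s : ℝ × ℝ) : ∑' ν : ℕ, f s * (z ^ ν * ∑ k ∈ J ν, φ k (t - s)) =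
        f s * poissonKernel z (t - s) := tsum_mul_left
    simpa only [e1, e2] using h
  · refine Summable.of_nonneg_of_le (fun ν => by positivity) (fun ν => ?_)
      ((summable_add_one_pow_mul_geometric 3 (norm_nonneg z) hz).mul_left
        ((∫ s, ‖f s‖ ∂μΩ) * 8))
    rw [mul_assoc, ← integral_mul_const]
    refine integral_mono_of_nonneg (.of_forall fun s => norm_nonneg _) (hfi.norm.mul_const _)
      (.of_forall fun s => ?_)
    change ‖f s * (z ^ ν * ∑ k ∈ J ν, φ k (t - s))‖ ≤ _
    rw [norm_mul, norm_mul, norm_pow]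
    have := norm_sum_J_le (fun k => φ k (t - s)) (C := 1) (fun k => (norm_φ k _).le) ν
    calc ‖f s‖ * (‖z‖ ^ ν * ‖∑ k ∈ J ν, φ k (t - s)‖)
        ≤ ‖f s‖ * (‖z‖ ^ ν * (1 * 8 * ((ν : ℝ) + 1) ^ 3)) := by gcongr
      _ = _ := by ring

theorem sum_eq_zero_of_mem_J {ν : ℕ} {k : Fin 3 → ℤ} (hk : k ∈ J ν) : ∑ j, k j = 0 :=
  (mem_J.mp hk).1

theorem fourierCoeff_φ {k l : Fin 3 → ℤ} (hk : ∑ j, k j = 0) (hl : ∑ j, l j = 0) :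
    fourierCoeff (φ k) l = if k = l then 1 else 0 := by
  have h : ∑ j, (k - l) j = 0 := by simp [Finset.sum_sub_distrib, hk, hl]
  have e : ∀ t, φ k t * (starRingEnd ℂ) (φ l t) = φ (k - l) t := fun t => by
    rw [conj_φ, ← φ_add, sub_eq_add_neg]
  simp only [fourierCoeff, e, integral_φ h, sub_eq_zero]

theorem integral_poissonKernel {z : ℂ} (hz : ‖z‖ < 1) (t : ℝ × ℝ) :
    ∫ s, poissonKernel z (t - s) ∂μΩ = 1 := by
  have h := hasSum_poisson_integral (f := φ 0) (by simpa [funext φ_zero] using memLp_const 1) hz t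
  simp only [φ_zero, one_mul] at h
  refine h.unique ?_
  have e : (fun ν : ℕ => z ^ ν * ∑ k ∈ J ν, fourierCoeff (φ 0) k * φ k t) =
      fun ν => if ν = 0 then 1 else 0 := by
    ext ν
    have : ∀ k ∈ J ν, fourierCoeff (φ 0) k * φ k t = if 0 = k then 1 else 0 := fun k hk => by
      rw [fourierCoeff_φ (by simp) (sum_eq_zero_of_mem_J hk)]
      split_ifs with h0
      · simp [← h0, φ_zero]
      · simp
    rw [Finset.sum_congr rfl this]
    rcases eq_or_ne ν 0 with rfl | hν
    · simp [J_zero]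
    · have h0 : (0 : Fin 3 → ℤ) ∉ J ν := fun h => hν (by
        rw [mem_J, maxAbs_eq] at h; simpa using h.2.symm)
      simp [hν, h0]
  rw [e]
  exact hasSum_ite_eq 0 1

theorem lintegral_poissonKernel {x : ℝ} (hx0 : 0 ≤ x) (hx1 : x < 1) (t : ℝ × ℝ) :
    ∫⁻ s, ENNReal.ofReal (poissonKernel x (t - s)).re ∂μΩ = 1 := by
  have hz : ‖(x : ℂ)‖ < 1 := by rwa [Complex.norm_real, Real.norm_of_nonneg hx0]
  have hre (s : ℝ × ℝ) : 0 ≤ (poissonKernel x (t - s)).re := by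
    obtain ⟨κ, h1, h2, -⟩ := exists_poissonKernel_dominated (t - s) hx0 hx1
    rwa [h2, Complex.ofReal_re]
  have hint : Integrable (fun s => poissonKernel x (t - s)) μΩ := by
    -- An undefined Bochner integral is 0 by convention, whereas this one equals 1.
    by_contra h
    have := integral_poissonKernel hz t
    rw [integral_undef h] at this
    exact zero_ne_one this
  have h0 := ofReal_integral_eq_lintegral_ofReal hint.re (.of_forall hre)
  simp only [RCLike.re_to_complex] at h0
  rw [← h0]
  have := integral_re hint
  simp only [RCLike.re_to_complex, integral_poissonKernel hz t] at this
  simp [this]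

/-- The kernel at z is dominated by 1000 times the positive kernel at x, which is doubly stochastic
because it has mean 1 and is even; the constant 1000 is absorbed into the function. -/
theorem eLpNorm_poisson_le {p : ℝ≥0∞} (hp : 1 ≤ p) {f : ℝ × ℝ → ℂ} (hf : MemLp f p μΩ) {x : ℝ}
    (hx : 1 / 2 ≤ x) (hx1 : x < 1) {z : ℂ} (hz : ‖z - x‖ ≤ (1 - x) / 2) :
    eLpNorm (fun t => ∑' ν : ℕ, z ^ ν * ∑ k ∈ J ν, fourierCoeff f k * φ k t) p μΩ ≤
      1000 * eLpNorm f p μΩ := by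
  have hx0 : 0 ≤ x := by linarith
  have hxn : ‖(x : ℂ)‖ < 1 := by rwa [Complex.norm_real, Real.norm_of_nonneg hx0]
  have hz1 := norm_lt_one_of_near hx0 hx1 hz
  have h := eLpNorm_le_of_kernel (μ := μΩ) (p := p)
    (K := fun t s => ENNReal.ofReal (poissonKernel x (t - s)).re)
    (f := (1000 : ℂ) • f)
    (u := fun t => ∑' ν : ℕ, z ^ ν * ∑ k ∈ J ν, fourierCoeff f k * φ k t)
    ?_ (lintegral_poissonKernel hx0 hx1) ?_ (hf.1.const_smul _) ?_ hp
  · refine h.trans_eq ?_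
    rw [eLpNorm_const_smul]
    congr 1
    simp [enorm_eq_nnnorm]
  · exact (ENNReal.continuous_ofReal.comp (Complex.continuous_re.comp
      ((continuous_poissonKernel hxn).comp (continuous_fst.sub continuous_snd)))).measurable
  · intro s
    rw [← lintegral_poissonKernel hx0 hx1 s]
    refine lintegral_congr fun t => ?_
    rw [← poissonKernel_neg, neg_sub]
  · intro t
    rw [(hasSum_poisson_integral (hf.mono_exponent hp) hz1 t).tsum_eq]
    refine (enorm_integral_le_lintegral_enorm _).trans (lintegral_mono fun s => ?_)
    obtain ⟨κ, h1, h2, h3⟩ := exists_poissonKernel_dominated (t - s) hx0 hx1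
    have h4 := h3 hx z hz
    simp only [h2, Complex.ofReal_re, Pi.smul_apply, smul_eq_mul]
    rw [enorm_mul, enorm_mul, mul_left_comm, mul_comm]
    rw [← mul_assoc]
    refine mul_le_mul_left ?_ _
    rw [← ofReal_norm, ← ofReal_norm, ← ENNReal.ofReal_mul (by positivity)]
    refine ENNReal.ofReal_le_ofReal (h4.trans_eq ?_)
    simp

/-! ### Abel summability in L_1. -/

/-- The formal sum `∑ a_ν H_ν(f)`, where `H_ν(f)` is the part of the Fourier series of `f` on
`|k| = ν`. -/
noncomputable def multiplierSum (a : ℕ → ℂ) (f : ℝ × ℝ → ℂ) (t : ℝ × ℝ) : ℂ :=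
  ∑' ν : ℕ, a ν * ∑ k ∈ J ν, fourierCoeff f k * φ k t

theorem poissonSum_eq_integral {f : ℝ × ℝ → ℂ} (hf : MemLp f 1 μΩ) {z : ℂ} (hz : ‖z‖ < 1)
    (t : ℝ × ℝ) : multiplierSum (z ^ ·) f t = ∫ s, f s * poissonKernel z (t - s) ∂μΩ :=
  (hasSum_poisson_integral hf hz t).tsum_eq

theorem norm_poissonKernel_le {z : ℂ} (hz : ‖z‖ < 1) : ∃ C, ∀ t, ‖poissonKernel z t‖ ≤ C := by
  refine ⟨∑' ν : ℕ, 8 * (((ν : ℝ) + 1) ^ 3 * ‖z‖ ^ ν), fun t => ?_⟩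
  refine tsum_of_norm_bounded
    ((summable_add_one_pow_mul_geometric 3 (norm_nonneg z) hz).mul_left 8).hasSum fun ν => ?_
  rw [norm_mul, norm_pow]
  have := norm_sum_J_le (fun k => φ k t) (C := 1) (fun k => (norm_φ k t).le) ν
  calc ‖z‖ ^ ν * ‖∑ k ∈ J ν, φ k t‖ ≤ ‖z‖ ^ ν * (1 * 8 * ((ν : ℝ) + 1) ^ 3) := by gcongr
    _ = _ := by ring

theorem integrable_mul_poissonKernel {f : ℝ × ℝ → ℂ} (hf : MemLp f 1 μΩ) {z : ℂ} (hz : ‖z‖ < 1)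
    (t : ℝ × ℝ) : Integrable (fun s => f s * poissonKernel z (t - s)) μΩ := by
  obtain ⟨C, hC⟩ := norm_poissonKernel_le hz
  exact (memLp_one_iff_integrable.mp hf).mul_bdd (c := C)
    ((continuous_poissonKernel hz).comp
      (continuous_const.sub continuous_id)).aestronglyMeasurable (.of_forall fun s => hC _)

theorem poissonSum_add {f g : ℝ × ℝ → ℂ} (hf : MemLp f 1 μΩ) (hg : MemLp g 1 μΩ) {z : ℂ}
    (hz : ‖z‖ < 1) :
    multiplierSum (z ^ ·) (f + g) = multiplierSum (z ^ ·) f + multiplierSum (z ^ ·) g := by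
  ext t
  rw [Pi.add_apply, poissonSum_eq_integral (hf.add hg) hz, poissonSum_eq_integral hf hz,
    poissonSum_eq_integral hg hz, ← integral_add (integrable_mul_poissonKernel hf hz t)
    (integrable_mul_poissonKernel hg hz t)]
  simp only [Pi.add_apply, add_mul]

theorem poissonSum_smul {f : ℝ × ℝ → ℂ} (hf : MemLp f 1 μΩ) (c : ℂ) {z : ℂ} (hz : ‖z‖ < 1) :
    multiplierSum (z ^ ·) (c • f) = c • multiplierSum (z ^ ·) f := by
  ext t
  rw [Pi.smul_apply, poissonSum_eq_integral (hf.const_smul c) hz, poissonSum_eq_integral hf hz,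
    ← integral_smul]
  simp only [Pi.smul_apply, smul_eq_mul, mul_assoc]

theorem poissonSum_sub {f g : ℝ × ℝ → ℂ} (hf : MemLp f 1 μΩ) (hg : MemLp g 1 μΩ) {z : ℂ}
    (hz : ‖z‖ < 1) :
    multiplierSum (z ^ ·) (f - g) = multiplierSum (z ^ ·) f - multiplierSum (z ^ ·) g := by
  have := poissonSum_add hf (hg.const_smul (-1 : ℂ)) hz
  rw [poissonSum_smul hg (-1) hz] at this
  simpa [sub_eq_add_neg] using this

theorem memLp_φ (k : Fin 3 → ℤ) (p : ℝ≥0∞) : MemLp (φ k) p μΩ :=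
  MemLp.of_bound (continuous_φ k).aestronglyMeasurable 1 (.of_forall fun t => (norm_φ k t).le)

theorem poissonSum_φ {k : Fin 3 → ℤ} (hk : ∑ j, k j = 0) (z : ℂ) :
    multiplierSum (z ^ ·) (φ k) = z ^ maxAbs k • φ k := by
  ext t
  have e (ν : ℕ) : z ^ ν * ∑ l ∈ J ν, fourierCoeff (φ k) l * φ l t =
      if ν = maxAbs k then z ^ maxAbs k * φ k t else 0 := by
    have : ∀ l ∈ J ν, fourierCoeff (φ k) l * φ l t = if k = l then φ k t else 0 := fun l hl => by
      rw [fourierCoeff_φ hk (sum_eq_zero_of_mem_J hl)]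
      split_ifs with h
      · rw [h, one_mul]
      · rw [zero_mul]
    rw [Finset.sum_congr rfl this, Finset.sum_ite_eq]
    by_cases h : ν = maxAbs k
    · rw [if_pos (mem_J.mpr ⟨hk, h.symm⟩), if_pos h, h]
    · rw [if_neg fun h' => h (mem_J.mp h').2.symm, if_neg h, mul_zero]
  rw [multiplierSum]
  simp only [e]
  rw [tsum_ite_eq]
  rfl

/-- The trigonometric polynomials on the hexagon. -/
noncomputable def trigPoly : Submodule ℂ (ℝ × ℝ → ℂ) :=
  Submodule.span ℂ {u | ∃ k : Fin 3 → ℤ, ∑ j, k j = 0 ∧ u = φ k}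

theorem memLp_of_mem_trigPoly {u : ℝ × ℝ → ℂ} (hu : u ∈ trigPoly) : MemLp u 1 μΩ := by
  induction hu using Submodule.span_induction with
  | mem u hu => obtain ⟨k, -, rfl⟩ := hu; exact memLp_φ k 1
  | zero => exact MemLp.zero
  | add u v _ _ hu hv => exact hu.add hv
  | smul c u _ hu => exact hu.const_smul c

theorem tendsto_ofReal_one : Tendsto (fun y : ℝ => (y : ℂ)) (𝓝[<] 1) (𝓝 1) :=
  (Complex.continuous_ofReal.tendsto' 1 1 Complex.ofReal_one).mono_left nhdsWithin_le_nhds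

theorem eventually_norm_ofReal_lt_one : ∀ᶠ y : ℝ in 𝓝[<] 1, ‖(y : ℂ)‖ < 1 := by
  filter_upwards [Ioo_mem_nhdsLT (show (0 : ℝ) < 1 by norm_num)] with y hy
  rw [Complex.norm_real, Real.norm_of_nonneg hy.1.le]
  exact hy.2

theorem continuous_poissonSum {f : ℝ × ℝ → ℂ} {z : ℂ} (hz : ‖z‖ < 1) :
    Continuous (multiplierSum (z ^ ·) f) := by
  refine continuous_tsum (fun ν => ?_)
    ((summable_add_one_pow_mul_geometric 3 (norm_nonneg z) hz).mul_left
      ((∫ t, ‖f t‖ ∂μΩ) * 8)) fun ν t => ?_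
  · exact continuous_const.mul (continuous_finsetSum _ fun k _ =>
      continuous_const.mul (continuous_φ k))
  · rw [norm_mul, norm_pow]
    have := norm_sum_J_le (fun k => fourierCoeff f k * φ k t) (C := ∫ t, ‖f t‖ ∂μΩ)
      (fun k => by rw [norm_mul, norm_φ, mul_one]; exact norm_fourierCoeff_le f k) ν
    calc ‖z‖ ^ ν * ‖∑ k ∈ J ν, fourierCoeff f k * φ k t‖
        ≤ ‖z‖ ^ ν * ((∫ t, ‖f t‖ ∂μΩ) * 8 * ((ν : ℝ) + 1) ^ 3) := by gcongr
      _ = _ := by ring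

theorem tendsto_poissonSum_of_mem_trigPoly {u : ℝ × ℝ → ℂ} (hu : u ∈ trigPoly) :
    Tendsto (fun y : ℝ => eLpNorm (u - multiplierSum ((y : ℂ) ^ ·) u) 1 μΩ) (𝓝[<] 1) (𝓝 0) := by
  have meas {v : ℝ × ℝ → ℂ} (hv : v ∈ trigPoly) {y : ℝ} (hy : ‖(y : ℂ)‖ < 1) :
      AEStronglyMeasurable (v - multiplierSum ((y : ℂ) ^ ·) v) μΩ :=
    (memLp_of_mem_trigPoly hv).1.sub (continuous_poissonSum hy).aestronglyMeasurable
  induction hu using Submodule.span_induction with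
  | mem u hu =>
    obtain ⟨k, hk, rfl⟩ := hu
    have e (y : ℝ) : eLpNorm (φ k - multiplierSum ((y : ℂ) ^ ·) (φ k)) 1 μΩ =
        ‖1 - (y : ℂ) ^ maxAbs k‖ₑ * eLpNorm (φ k) 1 μΩ := by
      rw [poissonSum_φ hk, ← eLpNorm_const_smul, sub_smul, one_smul]
    simp only [e]
    have h1 : Tendsto (fun y : ℝ => ‖1 - (y : ℂ) ^ maxAbs k‖ₑ) (𝓝[<] 1) (𝓝 0) := by
      have := (tendsto_const_nhds (x := (1 : ℂ))).sub (tendsto_ofReal_one.pow (maxAbs k))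
      simpa using this.enorm
    simpa using ENNReal.Tendsto.mul_const h1 (Or.inr (memLp_φ k 1).2.ne)
  | zero =>
    have e (y : ℝ) : multiplierSum ((y : ℂ) ^ ·) 0 = 0 := by
      ext t
      simp [multiplierSum, fourierCoeff]
    simp [e]
  | add u v hu' hv' hu hv =>
    refine tendsto_of_tendsto_of_tendsto_of_le_of_le' tendsto_const_nhds
      (by simpa using hu.add hv) (.of_forall fun _ => zero_le) ?_
    filter_upwards [eventually_norm_ofReal_lt_one] with y hy
    rw [poissonSum_add (memLp_of_mem_trigPoly hu') (memLp_of_mem_trigPoly hv') hy, add_sub_add_comm]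
    exact eLpNorm_add_le (meas hu' hy) (meas hv' hy) le_rfl
  | smul c u hu' hu =>
    have h1 := ENNReal.Tendsto.const_mul (a := ‖c‖ₑ) hu (Or.inr enorm_ne_top)
    rw [mul_zero] at h1
    refine h1.congr' ?_
    filter_upwards [eventually_norm_ofReal_lt_one] with y hy
    rw [poissonSum_smul (memLp_of_mem_trigPoly hu') c hy, ← smul_sub, eLpNorm_const_smul]

/-- The covering of the two-dimensional torus whose restriction to the hexagon is injective. -/
noncomputable def toTorus (t : ℝ × ℝ) : UnitAddTorus (Fin 2) :=
  ![(((2 * t.1 + t.2) / 3 : ℝ) : UnitAddCircle), (((t.1 + 2 * t.2) / 3 : ℝ) : UnitAddCircle)]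

theorem continuous_toTorus : Continuous toTorus := by
  refine continuous_pi fun i => ?_
  fin_cases i
  · exact (AddCircle.continuous_mk' 1).comp (by fun_prop)
  · exact (AddCircle.continuous_mk' 1).comp (by fun_prop)

theorem injOn_toTorus : InjOn toTorus Ω := by
  intro t ht s hs h
  have h0 := congrFun h 0
  have h1 := congrFun h 1
  simp only [toTorus, Matrix.cons_val_zero, Matrix.cons_val_one] at h0 h1
  obtain ⟨m, hm⟩ := AddSubgroup.mem_zmultiples_iff.mp (QuotientAddGroup.eq.mp h0)
  obtain ⟨n, hn⟩ := AddSubgroup.mem_zmultiples_iff.mp (QuotientAddGroup.eq.mp h1)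
  obtain ⟨a1, a2, a3, a4⟩ := mem_Ω.mp ht
  obtain ⟨b1, b2, b3, b4⟩ := mem_Ω.mp hs
  simp only [zsmul_eq_mul, mul_one] at hm hn
  have d1 : s.1 - t.1 = ((2 * m - n : ℤ) : ℝ) := by push_cast; linarith
  have d2 : s.2 - t.2 = ((2 * n - m : ℤ) : ℝ) := by push_cast; linarith
  have d3 : s.1 + s.2 - (t.1 + t.2) = ((m + n : ℤ) : ℝ) := by push_cast; linarith
  have c1 : ((2 * m - n : ℤ) : ℝ) < (2 : ℤ) := by rw [← d1]; push_cast; linarith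
  have c1' : ((-2 : ℤ) : ℝ) < ((2 * m - n : ℤ) : ℝ) := by rw [← d1]; push_cast; linarith
  have c2 : ((2 * n - m : ℤ) : ℝ) < (2 : ℤ) := by rw [← d2]; push_cast; linarith
  have c2' : ((-2 : ℤ) : ℝ) < ((2 * n - m : ℤ) : ℝ) := by rw [← d2]; push_cast; linarith
  have c3 : ((m + n : ℤ) : ℝ) < (2 : ℤ) := by rw [← d3]; push_cast; linarith
  have c3' : ((-2 : ℤ) : ℝ) < ((m + n : ℤ) : ℝ) := by rw [← d3]; push_cast; linarith
  rw [Int.cast_lt] at c1 c1' c2 c2' c3 c3'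
  have hm0 : m = 0 := by omega
  have hn0 : n = 0 := by omega
  rw [hm0, hn0] at d1 d2
  simp at d1 d2
  exact Prod.ext (by linarith) (by linarith)

theorem mFourier_toTorus (n : Fin 2 → ℤ) (t : ℝ × ℝ) :
    UnitAddTorus.mFourier n (toTorus t) = φ ![n 0, n 1, -n 0 - n 1] t := by
  simp only [UnitAddTorus.mFourier, ContinuousMap.coe_mk, Fin.prod_univ_two, toTorus,
    Matrix.cons_val_zero, Matrix.cons_val_one, fourier_coe_apply, ← Complex.exp_add, φ,
    Fin.sum_univ_three, coord]
  congr 1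
  simp
  ring

/-- The injective map `toTorus` transports f to an L_1 function on the torus for the image measure.
There bounded continuous functions are dense, and Stone–Weierstrass approximates them uniformly by
torus monomials, which pull back to the φ_k. -/
theorem exists_trigPoly_eLpNorm_sub_le {f : ℝ × ℝ → ℂ} (hf : MemLp f 1 μΩ) {ε : ℝ} (hε : 0 < ε) :
    ∃ u ∈ trigPoly, eLpNorm (f - u) 1 μΩ ≤ ENNReal.ofReal ε := by
  have hae : ∀ᵐ t ∂μΩ, t ∈ Ω := by
    rw [μΩ]
    exact Measure.ae_smul_measure (ae_restrict_mem measurableSet_Ω) _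
  have hmeas := continuous_toTorus.measurable
  set f' := hf.1.mk f
  have hff' : f =ᵐ[μΩ] f' := hf.1.ae_eq_mk
  have hf'm : Measurable f' := hf.1.stronglyMeasurable_mk.measurable
  have := measurableSet_Ω.standardBorel
  have hemb : MeasurableEmbedding (fun t : Ω => toTorus t) :=
    (hmeas.comp measurable_subtype_coe).measurableEmbedding (injOn_iff_injective.mp injOn_toTorus)
  set F : UnitAddTorus (Fin 2) → ℂ := Function.extend (fun t : Ω => toTorus t) (fun t => f' t) 0
  have hF : Measurable F := hemb.measurable_extend (hf'm.comp measurable_subtype_coe)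
    measurable_const
  have hFE : F ∘ toTorus =ᵐ[μΩ] f := by
    filter_upwards [hae, hff'] with t ht h
    rw [h]
    exact hemb.injective.extend_apply (fun t : Ω => f' t) 0 ⟨t, ht⟩
  set ν := μΩ.map toTorus
  have : IsProbabilityMeasure ν := Measure.isProbabilityMeasure_map hmeas.aemeasurable
  have hFL : MemLp F 1 ν := by
    rw [memLp_map_measure_iff hF.aestronglyMeasurable hmeas.aemeasurable]
    exact (memLp_congr_ae hFE).mpr hf
  obtain ⟨g, hg, -⟩ := hFL.exists_boundedContinuous_eLpNorm_sub_le ENNReal.one_ne_top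
    (ε := ENNReal.ofReal (ε / 2)) (by simpa using hε)
  have hdense : g.toContinuousMap ∈ (Submodule.span ℂ
      (range (UnitAddTorus.mFourier (d := Fin 2)))).topologicalClosure := by
    rw [UnitAddTorus.span_mFourier_closure_eq_top]
    trivial
  obtain ⟨q, hq, hgq⟩ := Metric.mem_closure_iff.mp hdense (ε / 2) (by positivity)
  refine ⟨q ∘ toTorus, ?_, ?_⟩
  · clear hgq
    induction hq using Submodule.span_induction with
    | mem q hq =>
      obtain ⟨n, rfl⟩ := hq
      refine Submodule.subset_span ⟨![n 0, n 1, -n 0 - n 1], ?_, funext fun t => ?_⟩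
      · simp [Fin.sum_univ_three]
      · exact mFourier_toTorus n t
    | zero => exact Submodule.zero_mem _
    | add u v _ _ hu hv => exact Submodule.add_mem _ hu hv
    | smul c u _ hu => exact Submodule.smul_mem _ c hu
  · have e1 : eLpNorm (f - q ∘ toTorus) 1 μΩ = eLpNorm (F - ⇑q) 1 ν := by
      rw [eLpNorm_map_measure (hF.aestronglyMeasurable.sub q.continuous.aestronglyMeasurable)
        hmeas.aemeasurable]
      refine eLpNorm_congr_ae ?_
      filter_upwards [hFE] with t ht
      simp [← ht]
    have e2 : eLpNorm (⇑g - ⇑q) 1 ν ≤ ENNReal.ofReal (ε / 2) := by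
      refine (eLpNorm_le_of_ae_bound (C := ε / 2) (.of_forall fun x => ?_)).trans_eq (by simp)
      have := (ContinuousMap.dist_apply_le_dist (f := g.toContinuousMap) (g := q) x).trans hgq.le
      rwa [dist_eq_norm] at this
    have e3 : F - ⇑q = (F - ⇑g) + (⇑g - ⇑q) := by abel
    rw [e1, e3]
    refine (eLpNorm_add_le (hF.aestronglyMeasurable.sub g.continuous.aestronglyMeasurable)
      (g.continuous.aestronglyMeasurable.sub q.continuous.aestronglyMeasurable) le_rfl).trans ?_
    refine (add_le_add hg e2).trans_eq ?_
    rw [← ENNReal.ofReal_add (by positivity) (by positivity), add_halves]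

theorem tendsto_eLpNorm_sub_poissonSum {f : ℝ × ℝ → ℂ} (hf : MemLp f 1 μΩ) :
    Tendsto (fun y : ℝ => eLpNorm (f - multiplierSum ((y : ℂ) ^ ·) f) 1 μΩ) (𝓝[<] 1) (𝓝 0) := by
  rw [ENNReal.tendsto_nhds_zero]
  intro ε hε
  -- 1002 = 1 + 1 + 1000: the approximation error, the Abel error of the polynomial, and the Poisson
  -- sum of the approximation error.
  obtain ⟨δ, hδ0, hδ⟩ : ∃ δ : ℝ, 0 < δ ∧ ENNReal.ofReal (1002 * δ) ≤ ε := by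
    rcases eq_or_ne ε ⊤ with rfl | h
    · exact ⟨1, one_pos, le_top⟩
    · refine ⟨ε.toReal / 1002, div_pos (ENNReal.toReal_pos hε.ne' h) (by norm_num), ?_⟩
      rw [mul_div_cancel₀ _ (by norm_num), ENNReal.ofReal_toReal h]
  obtain ⟨u, hu, hfu⟩ := exists_trigPoly_eLpNorm_sub_le hf hδ0
  have hu1 := memLp_of_mem_trigPoly hu
  filter_upwards [eventually_norm_ofReal_lt_one,
    Ioo_mem_nhdsLT (show (1 / 2 : ℝ) < 1 by norm_num),
    ENNReal.tendsto_nhds_zero.mp (tendsto_poissonSum_of_mem_trigPoly hu) (ENNReal.ofReal δ)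
      (by simpa using hδ0)] with y hy hy' hyu
  have e : f - multiplierSum ((y : ℂ) ^ ·) f = (f - u) + (u - multiplierSum ((y : ℂ) ^ ·) u) -
      multiplierSum ((y : ℂ) ^ ·) (f - u) := by
    rw [poissonSum_sub hf hu1 hy]
    abel
  have m1 := (continuous_poissonSum (f := u) hy).aestronglyMeasurable (μ := μΩ)
  have m2 := (continuous_poissonSum (f := f - u) hy).aestronglyMeasurable (μ := μΩ)
  have h3 := eLpNorm_poisson_le le_rfl (hf.sub hu1) hy'.1.le hy'.2 (z := y)
    (by simp; linarith [hy'.2])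
  rw [e]
  refine (eLpNorm_sub_le ((hf.1.sub hu1.1).add (hu1.1.sub m1)) m2 le_rfl).trans ?_
  refine (add_le_add ((eLpNorm_add_le (hf.1.sub hu1.1) (hu1.1.sub m1) le_rfl).trans
    (add_le_add hfu hyu)) (h3.trans (mul_le_mul_right hfu _))).trans (le_of_eq_of_le ?_ hδ)
  have : (1000 : ℝ≥0∞) = ENNReal.ofReal 1000 := by simp
  rw [this, ← ENNReal.ofReal_mul (by norm_num), ← ENNReal.ofReal_add hδ0.le hδ0.le,
    ← ENNReal.ofReal_add (by positivity) (by positivity)]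
  congr 1
  ring

/-! ### Power series with coefficients in a Banach space. -/

theorem PolyGrowth.shift {E : Type*} [NormedAddCommGroup E] {a : ℕ → E} (ha : PolyGrowth a)
    (m : ℕ) : PolyGrowth fun j => a (j + m) := by
  obtain ⟨C, d, hC, h⟩ := ha
  refine ⟨C * ((m : ℝ) + 1) ^ d, d, by positivity, fun j => (h _).trans ?_⟩
  rw [mul_assoc, ← mul_pow]
  gcongr
  push_cast
  nlinarith [mul_nonneg (Nat.cast_nonneg (α := ℝ) m) (Nat.cast_nonneg (α := ℝ) j)]

section PowerSeries

variable {E : Type*} [NormedAddCommGroup E] [NormedSpace ℂ E]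

theorem PolyGrowth.smul {c : ℕ → ℂ} {a : ℕ → E} (hc : PolyGrowth c) (ha : PolyGrowth a) :
    PolyGrowth fun j => c j • a j := by
  obtain ⟨C, d, hC, h⟩ := hc
  obtain ⟨C', d', hC', h'⟩ := ha
  refine ⟨C * C', d + d', by positivity, fun j => ?_⟩
  rw [norm_smul]
  calc ‖c j‖ * ‖a j‖ ≤ (C * ((j : ℝ) + 1) ^ d) * (C' * ((j : ℝ) + 1) ^ d') := by
        gcongr
        exacts [h j, h' j]
    _ = _ := by ring

theorem polyGrowth_descFactorial (n : ℕ) :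
    PolyGrowth fun j : ℕ => (((j + n).descFactorial n : ℕ) : ℂ) := by
  refine ⟨((n : ℝ) + 1) ^ n, n, by positivity, fun j => ?_⟩
  rw [Complex.norm_natCast, ← mul_pow]
  have : (((j + n).descFactorial n : ℕ) : ℝ) ≤ ((j + n : ℕ) : ℝ) ^ n := by
    exact_mod_cast Nat.descFactorial_le_pow _ _
  refine this.trans ?_
  gcongr
  push_cast
  nlinarith [mul_nonneg (Nat.cast_nonneg (α := ℝ) n) (Nat.cast_nonneg (α := ℝ) j)]

/-- The sum of the power series with coefficients `a`. -/
noncomputable def powSum (a : ℕ → E) (z : ℂ) : E := ∑' j : ℕ, z ^ j • a j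

/-- The coefficients of the `n`-th derivative of a power series. -/
noncomputable def derivCoeff (n : ℕ) (a : ℕ → E) (j : ℕ) : E :=
  ((j + n).descFactorial n : ℂ) • a (j + n)

theorem PolyGrowth.derivCoeff {a : ℕ → E} (ha : PolyGrowth a) (n : ℕ) :
    PolyGrowth (derivCoeff n a) :=
  (polyGrowth_descFactorial n).smul (ha.shift n)

variable [CompleteSpace E]

theorem powSum_add {a b : ℕ → E} (ha : PolyGrowth a) (hb : PolyGrowth b) {z : ℂ} (hz : ‖z‖ < 1) :
    powSum (fun j => a j + b j) z = powSum a z + powSum b z := by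
  simp only [powSum, smul_add]
  exact (ha.summable_smul hz).tsum_add (hb.summable_smul hz)

theorem powSum_sub {a b : ℕ → E} (ha : PolyGrowth a) (hb : PolyGrowth b) {z : ℂ} (hz : ‖z‖ < 1) :
    powSum (fun j => a j - b j) z = powSum a z - powSum b z := by
  simp only [powSum, smul_sub]
  exact (ha.summable_smul hz).tsum_sub (hb.summable_smul hz)

theorem hasDerivAt_powSum {a : ℕ → E} (ha : PolyGrowth a) {z : ℂ} (hz : ‖z‖ < 1) :
    HasDerivAt (powSum a) (powSum (derivCoeff 1 a) z) z := by
  obtain ⟨ρ, hρ, hρ1⟩ := exists_between hz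
  have hρ0 : 0 ≤ ρ := (norm_nonneg z).trans hρ.le
  have hu : Summable fun j : ℕ => ((j : ℝ) * ρ ^ (j - 1)) * ‖a j‖ := by
    rw [← summable_nat_add_iff 1]
    refine ((ha.derivCoeff 1).summable hρ0 hρ1).congr fun j => ?_
    rw [Hexagon.derivCoeff, norm_smul, Nat.descFactorial_one, Complex.norm_natCast]
    simp
    ring
  have h := hasDerivAt_tsum_of_isPreconnected (𝕜 := ℂ) (F := E) (g := fun j y => y ^ j • a j)
    (g' := fun j y => ((j : ℂ) * y ^ (j - 1)) • a j) (t := Metric.ball 0 ρ) (y₀ := 0) (y := z)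
    hu Metric.isOpen_ball (convex_ball _ _).isPreconnected
    (fun j y _ => (hasDerivAt_pow j y).smul_const (a j)) (fun j y hy => ?_)
    (by simpa using (norm_nonneg z).trans_lt hρ) (ha.summable_smul (by simp)) (by simpa using hρ)
  · have hs : Summable fun j : ℕ => ((j : ℂ) * z ^ (j - 1)) • a j := by
      refine Summable.of_norm_bounded hu fun j => ?_
      rw [norm_smul, norm_mul, norm_pow, Complex.norm_natCast]
      gcongr
    have e : ∑' j : ℕ, ((j : ℂ) * z ^ (j - 1)) • a j = powSum (Hexagon.derivCoeff 1 a) z := by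
      rw [hs.tsum_eq_zero_add]
      simp only [powSum, Hexagon.derivCoeff, smul_smul, Nat.descFactorial_one]
      simp [mul_comm]
    rw [e] at h
    exact h
  · rw [norm_smul, norm_mul, norm_pow, Complex.norm_natCast]
    have : ‖y‖ ≤ ρ := by simpa using (Metric.mem_ball.mp hy).le
    gcongr

theorem iteratedDeriv_powSum {a : ℕ → E} (ha : PolyGrowth a) (n : ℕ) {z : ℂ} (hz : ‖z‖ < 1) :
    iteratedDeriv n (powSum a) z = powSum (derivCoeff n a) z := by
  induction n generalizing z with
  | zero => simp [derivCoeff, powSum]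
  | succ n ih =>
    have hev : iteratedDeriv n (powSum a) =ᶠ[𝓝 z] powSum (derivCoeff n a) := by
      filter_upwards [Metric.isOpen_ball.mem_nhds
        (show z ∈ Metric.ball (0 : ℂ) 1 by simpa using hz)] with w hw
      exact ih (by simpa using hw)
    rw [iteratedDeriv_succ, hev.deriv_eq, (hasDerivAt_powSum (ha.derivCoeff n) hz).deriv]
    congr 1
    ext j
    simp only [derivCoeff, smul_smul, Nat.descFactorial_one]
    rw [← Nat.cast_mul, show j + 1 + n = j + (n + 1) by ring, Nat.descFactorial_succ,
      show j + (n + 1) - n = j + 1 by omega]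

/-- Cauchy's estimate on the circle of radius (1 - x)/2, the radius for which the kernel domination
holds. -/
theorem norm_powSum_derivCoeff_le {a : ℕ → E} (ha : PolyGrowth a) (n : ℕ) {x M : ℝ} (hx0 : 0 ≤ x)
    (hx1 : x < 1) (hM : ∀ z : ℂ, ‖z - x‖ ≤ (1 - x) / 2 → ‖powSum a z‖ ≤ M) :
    ‖powSum (derivCoeff n a) x‖ ≤ n.factorial * M / ((1 - x) / 2) ^ n := by
  have hR : 0 < (1 - x) / 2 := by linarith
  rw [← iteratedDeriv_powSum ha n (by rwa [Complex.norm_real, Real.norm_of_nonneg hx0])]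
  refine Complex.norm_iteratedDeriv_le_of_forall_mem_sphere_norm_le n hR ?_ fun z hz => hM z ?_
  · refine DifferentiableOn.diffContOnCl fun z hz => ?_
    rw [closure_ball _ hR.ne', Metric.mem_closedBall, dist_eq_norm] at hz
    exact (hasDerivAt_powSum ha
      (norm_lt_one_of_near hx0 hx1 hz)).differentiableAt.differentiableWithinAt
  · rw [Metric.mem_sphere, dist_eq_norm] at hz
    exact hz.le

theorem norm_powSum_shift_le {a : ℕ → E} (ha : PolyGrowth a) (m : ℕ) {z : ℂ} (hz : ‖z‖ < 1)
    (hz0 : 1 / 4 ≤ ‖z‖) : ‖powSum (fun j => a (j + m)) z‖ ≤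
      4 ^ m * (‖powSum a z‖ + ∑ ν ∈ Finset.range m, ‖a ν‖) := by
  have e : z ^ m • powSum (fun j => a (j + m)) z =
      powSum a z - ∑ ν ∈ Finset.range m, z ^ ν • a ν := by
    rw [powSum, powSum, ← (ha.summable_smul hz).sum_add_tsum_nat_add m, add_sub_cancel_left,
      ← ((ha.shift m).summable_smul hz).tsum_const_smul]
    simp only [smul_smul, ← pow_add, add_comm m]
  have h1 : ‖z‖ ^ m * ‖powSum (fun j => a (j + m)) z‖ ≤
      ‖powSum a z‖ + ∑ ν ∈ Finset.range m, ‖a ν‖ := by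
    rw [← norm_pow, ← norm_smul, e]
    refine (norm_sub_le _ _).trans (by
      gcongr
      refine (norm_sum_le _ _).trans (Finset.sum_le_sum fun ν _ => ?_)
      rw [norm_smul, norm_pow]
      exact mul_le_of_le_one_left (norm_nonneg _) (pow_le_one₀ (norm_nonneg _) hz.le))
  have h2 : (1 / 4 : ℝ) ^ m ≤ ‖z‖ ^ m := by gcongr
  calc ‖powSum (fun j => a (j + m)) z‖
      = 4 ^ m * ((1 / 4 : ℝ) ^ m * ‖powSum (fun j => a (j + m)) z‖) := by
        rw [← mul_assoc, ← mul_pow]; norm_num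
    _ ≤ 4 ^ m * (‖z‖ ^ m * ‖powSum (fun j => a (j + m)) z‖) := by gcongr
    _ ≤ _ := by gcongr

theorem polyGrowth_inv_add {q : ℕ} (hq : 1 ≤ q) : PolyGrowth fun j : ℕ => ((j + q : ℕ) : ℂ)⁻¹ := by
  refine ⟨1, 0, zero_le_one, fun j => ?_⟩
  rw [norm_inv, Complex.norm_natCast, pow_zero, mul_one]
  exact inv_le_one_of_one_le₀ (by exact_mod_cast (by omega : 1 ≤ j + q))

theorem norm_ofReal_lt_one {x : ℝ} (h0 : 0 ≤ x) (h1 : x < 1) : ‖(x : ℂ)‖ < 1 := by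
  rwa [Complex.norm_real, Real.norm_of_nonneg h0]

/-- Since 1/(j+q) = ∫_0^1 s^{j+q-1} ds, the new series is the integral of s^{q-1} times the old one
at us. This is why the bound M is required on all of [0, 1). -/
theorem norm_powSum_div_le {b : ℕ → E} (hb : PolyGrowth b) {q : ℕ} (hq : 1 ≤ q) {M : ℝ}
    (hM : ∀ u : ℝ, 0 ≤ u → u < 1 → ‖powSum b u‖ ≤ M) {u : ℝ} (hu0 : 0 ≤ u) (hu1 : u < 1) :
    ‖powSum (fun j => ((j + q : ℕ) : ℂ)⁻¹ • b j) u‖ ≤ M := by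
  have hM0 : 0 ≤ M := (norm_nonneg _).trans (hM 0 le_rfl zero_lt_one)
  have hsum := hb.summable hu0 hu1
  have hcont (j : ℕ) : Continuous fun s : ℝ =>
      ((s : ℂ) ^ (j + q - 1)) • ((u : ℂ) ^ j • b j) := by fun_prop
  have h := intervalIntegral.hasSum_integral_of_dominated_convergence (a := 0) (b := 1)
    (μ := volume) (F := fun (j : ℕ) (s : ℝ) => ((s : ℂ) ^ (j + q - 1)) • ((u : ℂ) ^ j • b j))
    (f := fun s => (s : ℂ) ^ (q - 1) • powSum b ((u * s : ℝ) : ℂ))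
    (fun j _ => u ^ j * ‖b j‖) (fun j => (hcont j).aestronglyMeasurable) ?_
    (.of_forall fun _ _ => hsum) (by simp) ?_
  · have e (j : ℕ) : ∫ s in (0 : ℝ)..1, ((s : ℂ) ^ (j + q - 1)) • ((u : ℂ) ^ j • b j) =
        (u : ℂ) ^ j • ((j + q : ℕ) : ℂ)⁻¹ • b j := by
      rw [intervalIntegral.integral_smul_const]
      have : ∫ s in (0 : ℝ)..1, (s : ℂ) ^ (j + q - 1) = ((j + q : ℕ) : ℂ)⁻¹ := by
        have h1 : ∫ s in (0 : ℝ)..1, (s : ℂ) ^ (j + q - 1) =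
            ((∫ s in (0 : ℝ)..1, s ^ (j + q - 1) : ℝ) : ℂ) := by
          rw [← intervalIntegral.integral_ofReal]
          simp
        rw [h1, integral_pow]
        have : j + q - 1 + 1 = j + q := by omega
        have h2 : ((j + q - 1 : ℕ) : ℝ) + 1 = ((j + q : ℕ) : ℝ) := by exact_mod_cast this
        rw [h2, this, zero_pow (by omega)]
        simp
      rw [this, smul_comm]
    simp only [e] at h
    rw [powSum, h.tsum_eq]
    refine (intervalIntegral.norm_integral_le_of_norm_le_const (C := M) fun s hs => ?_).trans
      (by simp)
    rw [uIoc_of_le zero_le_one] at hs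
    have hus : u * s < 1 := (mul_le_of_le_one_right hu0 hs.2).trans_lt hu1
    rw [norm_smul, norm_pow, Complex.norm_real, Real.norm_of_nonneg hs.1.le]
    calc s ^ (q - 1) * ‖powSum b ((u * s : ℝ) : ℂ)‖ ≤ 1 * M := by
          gcongr
          · exact pow_le_one₀ hs.1.le hs.2
          · exact hM _ (mul_nonneg hu0 hs.1.le) hus
      _ = M := one_mul M
  · refine fun j => .of_forall fun s hs => ?_
    rw [uIoc_of_le zero_le_one] at hs
    rw [norm_smul, norm_smul, norm_pow, norm_pow, Complex.norm_real, Complex.norm_real,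
      Real.norm_of_nonneg hs.1.le, Real.norm_of_nonneg hu0]
    exact mul_le_of_le_one_left (by positivity) (pow_le_one₀ hs.1.le hs.2)
  · refine .of_forall fun s hs => ?_
    rw [uIoc_of_le zero_le_one] at hs
    have hus : u * s < 1 := (mul_le_of_le_one_right hu0 hs.2).trans_lt hu1
    have h1 := ((hb.summable_smul
      (norm_ofReal_lt_one (mul_nonneg hu0 hs.1.le) hus)).hasSum).const_smul ((s : ℂ) ^ (q - 1))
    have e : (fun j : ℕ => (s : ℂ) ^ (j + q - 1) • (u : ℂ) ^ j • b j) =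
        fun j => (s : ℂ) ^ (q - 1) • ((u * s : ℝ) : ℂ) ^ j • b j := by
      ext j
      rw [smul_smul, smul_smul, Nat.add_sub_assoc hq]
      congr 1
      push_cast
      ring
    rw [e]
    exact h1

/-- The radial derivative of h carries the factor (j+m+n)⋯(j+m+1), while the n-th derivative of the
shifted series carries (j+n)⋯(j+1). The shift is lowered one unit at a time, each at the cost of a
factor 1 + n. -/
theorem norm_powSum_descFactorial_le {b : ℕ → E} (hb : PolyGrowth b) (n m : ℕ) {M : ℝ}
    (hM : ∀ u : ℝ, 0 ≤ u → u < 1 →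
      ‖powSum (fun j => ((j + m + n).descFactorial n : ℂ) • b j) u‖ ≤ M)
    {u : ℝ} (hu0 : 0 ≤ u) (hu1 : u < 1) :
    ‖powSum (fun j => ((j + n).descFactorial n : ℂ) • b j) u‖ ≤ (1 + n) ^ m * M := by
  induction m generalizing M with
  | zero => simpa using hM u hu0 hu1
  | succ m ih =>
    have hg : PolyGrowth fun j => ((j + (m + 1) + n).descFactorial n : ℂ) • b j :=
      PolyGrowth.smul (by simpa using (polyGrowth_descFactorial n).shift (m + 1)) hb
    have hq : 1 ≤ m + n + 1 := by omega
    -- The ratio of consecutive factors is (j+m+1)/(j+m+n+1) = 1 - n/(j+m+n+1), and the last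
    -- fraction is handled by `norm_powSum_div_le`.
    have e (j : ℕ) : ((j + m + n).descFactorial n : ℂ) • b j =
        ((j + (m + 1) + n).descFactorial n : ℂ) • b j - (n : ℂ) •
          (((j + (m + n + 1) : ℕ) : ℂ)⁻¹ • (((j + (m + 1) + n).descFactorial n : ℂ) • b j)) := by
      have h := Nat.succ_descFactorial (j + m + n) n
      have h' : ((j + m + 1 : ℕ) : ℂ) * ((j + (m + 1) + n).descFactorial n : ℂ) =
          ((j + (m + n + 1) : ℕ) : ℂ) * ((j + m + n).descFactorial n : ℂ) := by
        rw [← Nat.cast_mul, ← Nat.cast_mul]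
        congr 1
        convert h using 2
        · omega
        · congr 1; omega
        · omega
      have hne : ((j + (m + n + 1) : ℕ) : ℂ) ≠ 0 := by
        rw [Nat.cast_ne_zero]; omega
      rw [smul_smul, smul_smul, ← sub_smul]
      congr 1
      field_simp
      rw [mul_comm, ← h']
      push_cast
      ring
    rw [pow_succ, mul_assoc]
    refine ih fun v hv0 hv1 => ?_
    simp only [e]
    have hg2 := (polyGrowth_inv_add hq).smul hg
    have hg3 : PolyGrowth fun j => (n : ℂ) •
        (((j + (m + n + 1) : ℕ) : ℂ)⁻¹ • (((j + (m + 1) + n).descFactorial n : ℂ) • b j)) :=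
      PolyGrowth.smul (c := fun _ => (n : ℂ)) ⟨n, 0, by positivity, by simp⟩ hg2
    rw [powSum_sub hg hg3 (norm_ofReal_lt_one hv0 hv1)]
    have h2 := norm_powSum_div_le hg hq hM hv0 hv1
    have h3 : powSum (fun j => (n : ℂ) • (((j + (m + n + 1) : ℕ) : ℂ)⁻¹ •
        (((j + (m + 1) + n).descFactorial n : ℂ) • b j))) v = (n : ℂ) • powSum (fun j =>
        (((j + (m + n + 1) : ℕ) : ℂ)⁻¹ • (((j + (m + 1) + n).descFactorial n : ℂ) • b j))) v := by
      rw [powSum, powSum, ← (hg2.summable_smul (norm_ofReal_lt_one hv0 hv1)).tsum_const_smul]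
      simp only [smul_comm (n : ℂ)]
    rw [h3]
    refine (norm_sub_le _ _).trans ?_
    rw [norm_smul, Complex.norm_natCast, add_mul, one_mul]
    gcongr
    exact hM v hv0 hv1

end PowerSeries

/-! ### Integral form of the Taylor remainder. -/

/-- Differentiating a Taylor polynomial in its centre telescopes: only the contribution of the top
term survives. -/
theorem hasDerivAt_taylorSum (ν s : ℕ) (hs : s + 1 ≤ ν) (x : ℝ) :
    HasDerivAt (fun x : ℝ => ∑ j ∈ Finset.range (s + 1),
      (ν.choose j : ℝ) * (1 - x) ^ j * x ^ (ν - j))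
      ((1 - x) ^ s * (((s + 1 : ℕ) * ν.choose (s + 1) : ℕ) * x ^ (ν - (s + 1)))) x := by
  induction s with
  | zero =>
    simpa using hasDerivAt_pow ν x
  | succ s ih =>
    simp_rw [Finset.sum_range_succ _ (s + 1)]
    have h1 := ((((hasDerivAt_id x).const_sub 1).pow (s + 1)).const_mul
      (ν.choose (s + 1) : ℝ)).mul (hasDerivAt_pow (ν - (s + 1)) x)
    refine ((ih (by omega)).add h1).congr_deriv ?_
    have hc : (ν.choose (s + 2) : ℝ) * ((s + 1 + 1 : ℕ) : ℝ) =
        (ν.choose (s + 1) : ℝ) * ((ν - (s + 1) : ℕ) : ℝ) := by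
      exact_mod_cast Nat.choose_succ_right_eq ν (s + 1)
    have he : ν - (s + 1) - 1 = ν - (s + 1 + 1) := by omega
    rw [he]
    push_cast at hc ⊢
    simp only [id_eq, Pi.pow_apply]
    linear_combination (-(1 - x) ^ (s + 1) * x ^ (ν - (s + 1 + 1))) * hc

theorem one_sub_lam (s j : ℕ) (ϱ : ℝ) :
    1 - lam (s + 1) (j + (s + 1)) ϱ = ∫ x in ϱ..1,
      (1 - x) ^ s * (((j + (s + 1)).descFactorial (s + 1) / s.factorial : ℝ) * x ^ j) := by
  have hcoef : ((j + (s + 1)).descFactorial (s + 1) / s.factorial : ℝ) =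
      ((s + 1 : ℕ) * (j + (s + 1)).choose (s + 1) : ℕ) := by
    rw [Nat.descFactorial_eq_factorial_mul_choose, Nat.factorial_succ]
    have : (s.factorial : ℝ) ≠ 0 := by positivity
    field_simp
    push_cast
    ring
  have hd (x : ℝ) := hasDerivAt_taylorSum (j + (s + 1)) s (by omega) x
  simp only [Nat.add_sub_cancel] at hd
  rw [hcoef, intervalIntegral.integral_eq_sub_of_hasDerivAt (fun x _ => hd x)
    (by apply Continuous.intervalIntegrable; fun_prop), lam, if_neg (by omega)]
  congr 1
  -- At x = 1 every term with a positive power of 1 - x vanishes, and the remaining one is 1.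
  rw [Finset.sum_range_succ', Finset.sum_eq_zero]
  · simp
  · intro i _
    simp

section Remainder

variable {E : Type*} [NormedAddCommGroup E] [NormedSpace ℂ E] [CompleteSpace E]

/-- `one_sub_lam` is summed against y^ν a_ν. The Abel factor y < 1 makes the series converge
uniformly up to x = 1, so sum and integral can be exchanged; terms with ν < r vanish, and the factor
y^r/(r-1)! ≤ 1 is dropped. -/
theorem norm_tsum_one_sub_lam_le {a : ℕ → E} (ha : PolyGrowth a) {r : ℕ} (hr : 1 ≤ r) {y ϱ : ℝ}
    (hy0 : 0 ≤ y) (hy1 : y < 1) (hϱ0 : 0 ≤ ϱ) (hϱ1 : ϱ < 1) {B : ℝ → ℝ}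
    (hB : ∀ x, ϱ < x → x < 1 → (1 - x) ^ (r - 1) * ‖powSum (derivCoeff r a) (x * y : ℝ)‖ ≤ B x)
    (hBi : IntervalIntegrable B volume ϱ 1) :
    ‖∑' ν : ℕ, ((y : ℂ) ^ ν * (1 - lam r ν ϱ : ℝ)) • a ν‖ ≤ ∫ x in ϱ..1, B x := by
  obtain ⟨s, rfl⟩ := Nat.exists_eq_add_of_le' hr
  simp only [Nat.add_sub_cancel] at hB
  have hd := ha.derivCoeff (s + 1)
  set F : ℕ → ℝ → E := fun j x =>
    (((1 - x) ^ s / s.factorial * y ^ (s + 1) * (x * y) ^ j : ℝ) : ℂ) • derivCoeff (s + 1) a j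
  have hsf : (1 : ℝ) ≤ s.factorial := by
    exact_mod_cast Nat.one_le_iff_ne_zero.mpr s.factorial_ne_zero
  have hcoef {x : ℝ} (hx : x ∈ Ioc ϱ 1) : 0 ≤ (1 - x) ^ s / s.factorial * y ^ (s + 1) ∧
      (1 - x) ^ s / s.factorial * y ^ (s + 1) ≤ (1 - x) ^ s := by
    have h1 : 0 ≤ (1 - x) ^ s := pow_nonneg (by linarith [hx.2]) s
    refine ⟨by positivity, ?_⟩
    exact (mul_le_of_le_one_right (by positivity) (pow_le_one₀ hy0 hy1.le)).trans
      (div_le_self h1 hsf)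
  have hFc (j : ℕ) : Continuous (F j) := by fun_prop
  have h := intervalIntegral.hasSum_integral_of_dominated_convergence (a := ϱ) (b := 1)
    (μ := volume) (F := F)
    (f := fun x => (((1 - x) ^ s / s.factorial * y ^ (s + 1) : ℝ) : ℂ) •
      powSum (derivCoeff (s + 1) a) (x * y : ℝ))
    (fun j _ => y ^ j * ‖derivCoeff (s + 1) a j‖) (fun j => (hFc j).aestronglyMeasurable) ?_
    (.of_forall fun _ _ => hd.summable hy0 hy1) (by simp) ?_
  · have e (j : ℕ) : ∫ x in ϱ..1, F j x =
        ((y : ℂ) ^ (j + (s + 1)) * (1 - lam (s + 1) (j + (s + 1)) ϱ : ℝ)) • a (j + (s + 1)) := by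
      simp only [F]
      rw [intervalIntegral.integral_smul_const, derivCoeff, smul_smul, one_sub_lam]
      congr 1
      rw [← intervalIntegral.integral_ofReal, ← intervalIntegral.integral_const_mul,
        ← intervalIntegral.integral_mul_const]
      congr 1
      ext x
      push_cast
      ring
    simp only [e] at h
    have hz : ∀ ν ∈ Finset.range (s + 1),
        ((y : ℂ) ^ ν * (1 - lam (s + 1) ν ϱ : ℝ)) • a ν = 0 := fun ν hν => by
      simp [lam, Finset.mem_range.mp hν]
    have h' := (hasSum_nat_add_iff (f := fun ν : ℕ =>
      ((y : ℂ) ^ ν * (1 - lam (s + 1) ν ϱ : ℝ)) • a ν) (s + 1)).mp h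
    rw [Finset.sum_eq_zero hz, add_zero] at h'
    rw [h'.tsum_eq]
    refine intervalIntegral.norm_integral_le_of_norm_le hϱ1.le ?_ hBi
    have h1 : ∀ᵐ x : ℝ, x ≠ 1 := Measure.ae_ne volume 1
    filter_upwards [h1] with x hx1 hx
    refine le_trans ?_ (hB x hx.1 (lt_of_le_of_ne hx.2 hx1))
    rw [norm_smul, Complex.norm_real, Real.norm_of_nonneg (hcoef hx).1]
    gcongr
    exact (hcoef hx).2
  · refine fun j => .of_forall fun x hx => ?_
    rw [uIoc_of_le hϱ1.le] at hx
    have hx0 : 0 ≤ x := hϱ0.trans hx.1.le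
    obtain ⟨c0, c1⟩ := hcoef hx
    have c2 : (1 - x) ^ s ≤ 1 := pow_le_one₀ (by linarith [hx.2]) (by linarith)
    have c3 : (x * y) ^ j ≤ y ^ j := by
      gcongr
      exact mul_le_of_le_one_left hy0 hx.2
    have c4 : 0 ≤ (x * y) ^ j := by positivity
    rw [norm_smul, Complex.norm_real, Real.norm_of_nonneg (mul_nonneg c0 c4)]
    gcongr
    nlinarith
  · refine .of_forall fun x hx => ?_
    rw [uIoc_of_le hϱ1.le] at hx
    have hx0 : 0 ≤ x := hϱ0.trans hx.1.le
    have hxy : x * y < 1 := (mul_le_of_le_one_left hy0 hx.2).trans_lt hy1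
    have h1 := ((hd.summable_smul
      (norm_ofReal_lt_one (mul_nonneg hx0 hy0) hxy)).hasSum).const_smul
      (((1 - x) ^ s / s.factorial * y ^ (s + 1) : ℝ) : ℂ)
    have e : (fun j => F j x) = fun j => (((1 - x) ^ s / s.factorial * y ^ (s + 1) : ℝ) : ℂ) •
        ((x * y : ℝ) : ℂ) ^ j • derivCoeff (s + 1) a j := by
      ext j
      rw [smul_smul, ← Complex.ofReal_pow, ← Complex.ofReal_mul]
    rw [e]
    exact h1

end Remainder

/-! ### The L_p-valued series of f and the bound for its r-th derivative. -/

/-- The part of the Fourier series of `f` on `|k| = ν`, as a bounded continuous function. -/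
noncomputable def harmonicPart (f : ℝ × ℝ → ℂ) (ν : ℕ) : BoundedContinuousFunction (ℝ × ℝ) ℂ :=
  BoundedContinuousFunction.ofNormedAddCommGroup (fun t => ∑ k ∈ J ν, fourierCoeff f k * φ k t)
    (continuous_finsetSum _ fun k _ => continuous_const.mul (continuous_φ k))
    ((∫ t, ‖f t‖ ∂μΩ) * 8 * ((ν : ℝ) + 1) ^ 3) fun t =>
      norm_sum_J_le (fun k => fourierCoeff f k * φ k t)
        (fun k => by rw [norm_mul, norm_φ, mul_one]; exact norm_fourierCoeff_le f k) ν

theorem harmonicPart_apply (f : ℝ × ℝ → ℂ) (ν : ℕ) (t : ℝ × ℝ) :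
    harmonicPart f ν t = ∑ k ∈ J ν, fourierCoeff f k * φ k t := rfl

theorem norm_harmonicPart_le (f : ℝ × ℝ → ℂ) (ν : ℕ) :
    ‖harmonicPart f ν‖ ≤ (∫ t, ‖f t‖ ∂μΩ) * 8 * ((ν : ℝ) + 1) ^ 3 :=
  BoundedContinuousFunction.norm_ofNormedAddCommGroup_le _
    (by have := integral_nonneg (μ := μΩ) (f := fun t => ‖f t‖) fun t => norm_nonneg _
        positivity) _

theorem polyGrowth_harmonicPart (f : ℝ × ℝ → ℂ) : PolyGrowth (harmonicPart f) :=
  ⟨_, 3, by have := integral_nonneg (μ := μΩ) (f := fun t => ‖f t‖) fun t => norm_nonneg _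
            positivity, norm_harmonicPart_le f⟩

theorem harmonicPart_sub {g h : ℝ × ℝ → ℂ} (hg : MemLp g 1 μΩ) (hh : MemLp h 1 μΩ) (ν : ℕ) :
    harmonicPart (g - h) ν = harmonicPart g ν - harmonicPart h ν := by
  have hc (k : Fin 3 → ℤ) : fourierCoeff (g - h) k = fourierCoeff g k - fourierCoeff h k := by
    have hi {f : ℝ × ℝ → ℂ} (hf : MemLp f 1 μΩ) :
        Integrable (fun t => f t * (starRingEnd ℂ) (φ k t)) μΩ :=
      (memLp_one_iff_integrable.mp hf).mul_bdd (c := 1)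
        (Complex.continuous_conj.comp (continuous_φ k)).aestronglyMeasurable
        (.of_forall fun t => by simp [norm_φ])
    rw [fourierCoeff, fourierCoeff, fourierCoeff, ← integral_sub (hi hg) (hi hh)]
    simp only [Pi.sub_apply, sub_mul]
  ext t
  rw [BoundedContinuousFunction.sub_apply]
  simp only [harmonicPart_apply, hc, sub_mul, Finset.sum_sub_distrib]

theorem harmonicPart_radialDeriv {m : ℕ} {f g : ℝ × ℝ → ℂ} (hg : IsRadialDeriv m f g) {ν : ℕ}
    (hν : m ≤ ν) : harmonicPart g ν = (ν.descFactorial m : ℂ) • harmonicPart f ν := by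
  ext t
  rw [BoundedContinuousFunction.smul_apply, harmonicPart_apply, harmonicPart_apply, smul_eq_mul,
    Finset.mul_sum]
  refine Finset.sum_congr rfl fun k hk => ?_
  rw [hg.2.2 k (sum_eq_zero_of_mem_J hk), (mem_J.mp hk).2, if_neg (by omega), mul_assoc]
  congr 1
  rw [← Nat.factorial_mul_descFactorial hν, Nat.cast_mul]
  exact mul_div_cancel_left₀ _ (by exact_mod_cast Nat.factorial_ne_zero _)

section Lp

variable (p : ℝ≥0∞) [hp : Fact (1 ≤ p)]

/-- The part of the Fourier series of `f` on `|k| = ν`, as an element of `L_p`. -/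
noncomputable def harmonicLp (f : ℝ × ℝ → ℂ) (ν : ℕ) : Lp ℂ p μΩ :=
  BoundedContinuousFunction.toLp p μΩ ℂ (harmonicPart f ν)

theorem norm_toLp_le (b : BoundedContinuousFunction (ℝ × ℝ) ℂ) :
    ‖BoundedContinuousFunction.toLp p μΩ ℂ b‖ ≤ ‖b‖ := by
  refine (BoundedContinuousFunction.Lp_norm_le b).trans_eq ?_
  simp [measureUnivNNReal]

theorem polyGrowth_harmonicLp (f : ℝ × ℝ → ℂ) : PolyGrowth (harmonicLp p f) := by
  obtain ⟨C, d, hC, h⟩ := polyGrowth_harmonicPart f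
  exact ⟨C, d, hC, fun ν => (norm_toLp_le p _).trans (h ν)⟩

theorem summable_smul_harmonicPart {c : ℕ → ℂ} (f : ℝ × ℝ → ℂ)
    (hc : Summable fun ν : ℕ => ‖c ν‖ * ((ν : ℝ) + 1) ^ 3) :
    Summable fun ν => c ν • harmonicPart f ν := by
  refine Summable.of_norm_bounded (hc.mul_left ((∫ t, ‖f t‖ ∂μΩ) * 8)) fun ν => ?_
  rw [norm_smul]
  calc ‖c ν‖ * ‖harmonicPart f ν‖
      ≤ ‖c ν‖ * ((∫ t, ‖f t‖ ∂μΩ) * 8 * ((ν : ℝ) + 1) ^ 3) := by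
        gcongr; exact norm_harmonicPart_le f ν
    _ = _ := by ring

theorem multiplierSum_eq_tsum {c : ℕ → ℂ} (f : ℝ × ℝ → ℂ)
    (hc : Summable fun ν : ℕ => ‖c ν‖ * ((ν : ℝ) + 1) ^ 3) :
    multiplierSum c f = ⇑(∑' ν, c ν • harmonicPart f ν) := by
  ext t
  have h := (BoundedContinuousFunction.evalCLM ℂ t).map_tsum (summable_smul_harmonicPart f hc)
  simpa [multiplierSum, harmonicPart_apply] using h.symm

/-- The sup norm of the ν-th part grows at most like (ν+1)^3, so the series converges uniformly and
its pointwise sum represents the sum in L_p. This links functions with the Banach-valued power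
series. -/
theorem eLpNorm_multiplierSum {c : ℕ → ℂ} (f : ℝ × ℝ → ℂ)
    (hc : Summable fun ν : ℕ => ‖c ν‖ * ((ν : ℝ) + 1) ^ 3) :
    eLpNorm (multiplierSum c f) p μΩ = ENNReal.ofReal ‖∑' ν, c ν • harmonicLp p f ν‖ := by
  have h := (BoundedContinuousFunction.toLp p μΩ ℂ).map_tsum (summable_smul_harmonicPart f hc)
  simp only [map_smul] at h
  simp only [harmonicLp]
  rw [← h, multiplierSum_eq_tsum f hc, ofReal_norm, Lp.enorm_def]
  exact (eLpNorm_congr_ae (BoundedContinuousFunction.coeFn_toLp p μΩ ℂ _)).symm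

theorem summable_norm_pow_mul {z : ℂ} (hz : ‖z‖ < 1) :
    Summable fun ν : ℕ => ‖z ^ ν‖ * ((ν : ℝ) + 1) ^ 3 :=
  (summable_add_one_pow_mul_geometric 3 (norm_nonneg z) hz).congr fun ν => by
    rw [norm_pow, mul_comm]

theorem norm_powSum_harmonicLp_le {f : ℝ × ℝ → ℂ} (hf : MemLp f p μΩ) {x : ℝ} (hx : 1 / 2 ≤ x)
    (hx1 : x < 1) {z : ℂ} (hz : ‖z - x‖ ≤ (1 - x) / 2) :
    ‖powSum (harmonicLp p f) z‖ ≤ 1000 * (eLpNorm f p μΩ).toReal := by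
  have h := eLpNorm_poisson_le hp.out hf hx hx1 hz
  have h' := eLpNorm_multiplierSum p f
    (summable_norm_pow_mul (norm_lt_one_of_near (by linarith) hx1 hz))
  have h2 := h'.symm.trans_le h
  rw [powSum]
  have h3 := ENNReal.toReal_mono (ENNReal.mul_ne_top (by simp) hf.2.ne) h2
  rw [ENNReal.toReal_ofReal (norm_nonneg _), ENNReal.toReal_mul] at h3
  simpa using h3

theorem norm_harmonicLp_le {f : ℝ × ℝ → ℂ} (hf : MemLp f p μΩ) (ν : ℕ) :
    ‖harmonicLp p f ν‖ ≤ 8 * ((ν : ℝ) + 1) ^ 3 * (eLpNorm f p μΩ).toReal := by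
  have h1 : ∫ t, ‖f t‖ ∂μΩ ≤ (eLpNorm f p μΩ).toReal := by
    rw [integral_norm_eq_lintegral_enorm hf.1, ← eLpNorm_one_eq_lintegral_enorm]
    exact ENNReal.toReal_mono hf.2.ne (eLpNorm_le_eLpNorm_of_exponent_le hp.out hf.1)
  refine (norm_toLp_le p _).trans ((norm_harmonicPart_le f ν).trans ?_)
  calc (∫ t, ‖f t‖ ∂μΩ) * 8 * ((ν : ℝ) + 1) ^ 3
      ≤ (eLpNorm f p μΩ).toReal * 8 * ((ν : ℝ) + 1) ^ 3 := by gcongr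
    _ = _ := by ring

/-- A bound for the partial sums of the norms of the projections on `|k| = ν`, `ν < r`. -/
theorem sum_norm_harmonicLp_le {f : ℝ × ℝ → ℂ} (hf : MemLp f p μΩ) (r : ℕ) :
    ∑ ν ∈ Finset.range r, ‖harmonicLp p f ν‖ ≤
      (∑ ν ∈ Finset.range r, 8 * ((ν : ℝ) + 1) ^ 3) * (eLpNorm f p μΩ).toReal := by
  rw [Finset.sum_mul]
  exact Finset.sum_le_sum fun ν _ => norm_harmonicLp_le p hf ν

theorem norm_powSum_shift_harmonicLp_le {f : ℝ × ℝ → ℂ} (hf : MemLp f p μΩ) (r : ℕ) {x : ℝ}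
    (hx : 1 / 2 ≤ x) (hx1 : x < 1) {z : ℂ} (hz : ‖z - x‖ ≤ (1 - x) / 2) :
    ‖powSum (fun j => harmonicLp p f (j + r)) z‖ ≤
      4 ^ r * (1000 + ∑ ν ∈ Finset.range r, 8 * ((ν : ℝ) + 1) ^ 3) *
        (eLpNorm f p μΩ).toReal := by
  have hz1 := norm_lt_one_of_near (by linarith) hx1 hz
  have hz0 : 1 / 4 ≤ ‖z‖ := by
    have := norm_le_norm_add_norm_sub z (x : ℂ)
    rw [Complex.norm_real, Real.norm_of_nonneg (by linarith)] at this
    linarith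
  refine (norm_powSum_shift_le (polyGrowth_harmonicLp p f) r hz1 hz0).trans ?_
  rw [mul_assoc, add_mul]
  gcongr
  · exact norm_powSum_harmonicLp_le p hf hx hx1 hz
  · exact sum_norm_harmonicLp_le p hf r

/-- The averaging in `norm_powSum_div_le` reaches small radii, where the kernel bound is not
available; for u ≤ 1/2 comparison with a convergent series of ratio 1/2 suffices. -/
theorem exists_norm_powSum_shift_le (r : ℕ) : ∃ C : ℝ, 0 ≤ C ∧ ∀ f : ℝ × ℝ → ℂ, MemLp f p μΩ →
    ∀ u : ℝ, 0 ≤ u → u < 1 →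
      ‖powSum (fun j => harmonicLp p f (j + r)) u‖ ≤ C * (eLpNorm f p μΩ).toReal := by
  set b : ℕ → ℝ := fun j => (1 / 2) ^ j * (8 * (((j + r : ℕ) : ℝ) + 1) ^ 3)
  have hb : Summable b := by
    have h := (summable_nat_add_iff r).mpr
      (summable_add_one_pow_mul_geometric 3 (ρ := 1 / 2) (by norm_num) (by norm_num))
    refine (h.mul_left (8 * 2 ^ r)).congr fun j => ?_
    simp only [b, pow_add (1 / 2 : ℝ)]
    have : (2 : ℝ) ^ r * (1 / 2) ^ r = 1 := by rw [← mul_pow]; norm_num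
    linear_combination (8 * (((j + r : ℕ) : ℝ) + 1) ^ 3 * (1 / 2) ^ j) * this
  have hb0 : 0 ≤ ∑' j, b j := tsum_nonneg fun j => by positivity
  set C := 4 ^ r * (1000 + ∑ ν ∈ Finset.range r, 8 * ((ν : ℝ) + 1) ^ 3)
  have hC : 0 ≤ C := by positivity
  refine ⟨C + ∑' j, b j, by positivity, fun f hf u hu0 hu1 => ?_⟩
  rw [add_mul]
  rcases le_total (1 / 2) u with hu | hu
  · refine (norm_powSum_shift_harmonicLp_le p hf r hu hu1 (z := u) ?_).trans
      (le_add_of_nonneg_right (by positivity))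
    simp only [sub_self, norm_zero]
    linarith
  · refine le_trans ?_ (le_add_of_nonneg_left (by positivity))
    refine tsum_of_norm_bounded (hb.hasSum.mul_right (eLpNorm f p μΩ).toReal) fun j => ?_
    rw [norm_smul, norm_pow, Complex.norm_real, Real.norm_of_nonneg hu0]
    simp only [b, mul_assoc ((1 / 2 : ℝ) ^ j)]
    gcongr
    exact norm_harmonicLp_le p hf (j + r)

theorem exists_norm_powSum_derivCoeff_le (m n : ℕ) : ∃ C : ℝ, 0 ≤ C ∧
    ∀ f g h d : ℝ × ℝ → ℂ, IsRadialDeriv m f g → IsRadialDeriv n h d → MemLp (g - h) p μΩ →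
      MemLp d p μΩ → ∀ u : ℝ, 1 / 2 ≤ u → u < 1 →
        (1 - u) ^ n * ‖powSum (derivCoeff (m + n) (harmonicLp p f)) u‖ ≤
          C * ((eLpNorm (g - h) p μΩ).toReal + (1 - u) ^ n * (eLpNorm d p μΩ).toReal) := by
  obtain ⟨C₁, hC₁, h₁⟩ := exists_norm_powSum_shift_le p (m + n)
  set C₂ := 4 ^ m * (1000 + ∑ ν ∈ Finset.range m, 8 * ((ν : ℝ) + 1) ^ 3)
  have hC₂ : 0 ≤ C₂ := by positivity
  refine ⟨n.factorial * C₂ * 2 ^ n + (1 + n) ^ m * C₁, by positivity,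
    fun f g h d hg hd hgh hdp u hu hu1 => ?_⟩
  have hu0 : 0 ≤ u := by linarith
  have hun := norm_ofReal_lt_one hu0 hu1
  -- The product (j+m+n)⋯(j+1) splits into the m factors that turn f into g and the n factors of an
  -- n-th derivative; then g = (g - h) + h.
  have e (j : ℕ) : derivCoeff (m + n) (harmonicLp p f) j =
      derivCoeff n (fun j => harmonicLp p (g - h) (j + m)) j +
        ((j + n).descFactorial n : ℂ) • harmonicLp p h (j + (m + n)) := by
    have e1 : harmonicLp p (g - h) (j + (m + n)) =
        harmonicLp p g (j + (m + n)) - harmonicLp p h (j + (m + n)) := by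
      rw [harmonicLp, harmonicPart_sub hg.2.1 hd.1, map_sub]
      rfl
    have e2 : harmonicLp p g (j + (m + n)) =
        ((j + (m + n)).descFactorial m : ℂ) • harmonicLp p f (j + (m + n)) := by
      rw [harmonicLp, harmonicPart_radialDeriv hg (by omega), map_smul]
      rfl
    have e3 : (((j + (m + n)).descFactorial (m + n) : ℕ) : ℂ) =
        ((j + n).descFactorial n : ℂ) * ((j + (m + n)).descFactorial m : ℂ) := by
      rw [← Nat.cast_mul]
      have := Nat.descFactorial_mul_descFactorial (n := j + (m + n)) (show m ≤ m + n by omega)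
      rw [← this]
      congr 3 <;> omega
    simp only [derivCoeff]
    rw [show j + n + m = j + (m + n) by ring, e1, e2, e3, mul_smul, ← smul_add, sub_add_cancel]
  have pg1 : PolyGrowth (derivCoeff n (fun j => harmonicLp p (g - h) (j + m))) :=
    ((polyGrowth_harmonicLp p _).shift m).derivCoeff n
  have pg2 : PolyGrowth (fun j => harmonicLp p h (j + (m + n))) :=
    (polyGrowth_harmonicLp p h).shift _
  have b1 := norm_powSum_derivCoeff_le ((polyGrowth_harmonicLp p (g - h)).shift m) n hu0 hu1
    fun z hz => norm_powSum_shift_harmonicLp_le p hgh m hu hu1 hz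
  change _ ≤ n.factorial * (C₂ * _) / _ at b1
  have b2 := norm_powSum_descFactorial_le pg2 n m (M := C₁ * (eLpNorm d p μΩ).toReal)
    (fun v hv0 hv1 => ?_) hu0 hu1
  · rw [show derivCoeff (m + n) (harmonicLp p f) = _ from funext e,
      powSum_add pg1 ((polyGrowth_descFactorial n).smul pg2) hun]
    have hpos : 0 < (1 - u) ^ n := pow_pos (by linarith) n
    have hN : 0 ≤ (eLpNorm (g - h) p μΩ).toReal := ENNReal.toReal_nonneg
    have hN' : 0 ≤ (eLpNorm d p μΩ).toReal := ENNReal.toReal_nonneg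
    have b1' : (1 - u) ^ n * ‖powSum (derivCoeff n fun j => harmonicLp p (g - h) (j + m)) u‖ ≤
        n.factorial * C₂ * 2 ^ n * (eLpNorm (g - h) p μΩ).toReal := by
      refine (mul_le_mul_of_nonneg_left b1 hpos.le).trans_eq ?_
      rw [div_pow]
      field_simp
    have b2' := mul_le_mul_of_nonneg_left b2 hpos.le
    calc _ ≤ (1 - u) ^ n * (_ + _) := mul_le_mul_of_nonneg_left (norm_add_le _ _) hpos.le
      _ ≤ n.factorial * C₂ * 2 ^ n * (eLpNorm (g - h) p μΩ).toReal +
          (1 - u) ^ n * ((1 + n) ^ m * (C₁ * (eLpNorm d p μΩ).toReal)) := by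
        rw [mul_add]
        exact add_le_add b1' b2'
      _ ≤ _ := by
        have q1 : 0 ≤ n.factorial * C₂ * 2 ^ n * ((1 - u) ^ n * (eLpNorm d p μΩ).toReal) := by
          positivity
        have q2 : 0 ≤ (1 + n : ℝ) ^ m * C₁ * (eLpNorm (g - h) p μΩ).toReal := by positivity
        linarith
  · have := h₁ d hdp v hv0 hv1
    have hh (j : ℕ) : ((j + m + n).descFactorial n : ℂ) • harmonicLp p h (j + (m + n)) =
        harmonicLp p d (j + (m + n)) := by
      have := congrArg (BoundedContinuousFunction.toLp p μΩ ℂ)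
        (harmonicPart_radialDeriv hd (ν := j + (m + n)) (by omega))
      rw [map_smul] at this
      rw [add_assoc]
      exact this.symm
    simpa only [hh] using this

end Lp

/-! ### Removing the Abel factor, and the final estimate. -/

theorem abs_lam_le {r : ℕ} (hr : 1 ≤ r) {ϱ : ℝ} (h0 : 0 < ϱ) (h1 : ϱ < 1) (ν : ℕ) :
    |lam r ν ϱ| ≤ r * (ϱ ^ r)⁻¹ * (((ν : ℝ) + 1) ^ r * ϱ ^ ν) := by
  have hr' : (1 : ℝ) ≤ r := by exact_mod_cast hr
  have hν : (1 : ℝ) ≤ (ν : ℝ) + 1 := by linarith [Nat.cast_nonneg (α := ℝ) ν]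
  rw [lam]
  split_ifs with h
  · have hp : ϱ ^ r ≤ ϱ ^ ν := pow_le_pow_of_le_one h0.le h1.le h.le
    have h2 : 1 ≤ (ϱ ^ r)⁻¹ * ϱ ^ ν := by
      rw [inv_mul_eq_div, one_le_div (by positivity)]
      exact hp
    rw [abs_one]
    calc (1 : ℝ) = 1 * (1 * 1) := by norm_num
      _ ≤ r * (((ν : ℝ) + 1) ^ r * ((ϱ ^ r)⁻¹ * ϱ ^ ν)) := by
        gcongr
        exact one_le_pow₀ hν
      _ = _ := by ring
  · refine (Finset.abs_sum_le_sum_abs _ _).trans ?_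
    refine (Finset.sum_le_card_nsmul _ _ ((ϱ ^ r)⁻¹ * (((ν : ℝ) + 1) ^ r * ϱ ^ ν))
      fun j hj => ?_).trans_eq (by rw [Finset.card_range, nsmul_eq_mul, mul_assoc])
    have hjr := Finset.mem_range.mp hj
    have h1' : 0 ≤ 1 - ϱ := by linarith
    rw [abs_of_nonneg (by positivity)]
    have b1 : (ν.choose j : ℝ) ≤ ((ν : ℝ) + 1) ^ r := by
      have : (ν.choose j : ℝ) ≤ (ν : ℝ) ^ j := by exact_mod_cast Nat.choose_le_pow ν j
      calc (ν.choose j : ℝ) ≤ (ν : ℝ) ^ j := this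
        _ ≤ ((ν : ℝ) + 1) ^ j := by gcongr; linarith
        _ ≤ ((ν : ℝ) + 1) ^ r := pow_le_pow_right₀ hν hjr.le
    have b2 : (1 - ϱ) ^ j ≤ 1 := pow_le_one₀ h1' (by linarith)
    have b3 : ϱ ^ (ν - j) ≤ (ϱ ^ r)⁻¹ * ϱ ^ ν := by
      rw [inv_mul_eq_div, le_div_iff₀ (by positivity), ← pow_add]
      exact pow_le_pow_of_le_one h0.le h1.le (by omega)
    calc (ν.choose j : ℝ) * (1 - ϱ) ^ j * ϱ ^ (ν - j)
        ≤ ((ν : ℝ) + 1) ^ r * 1 * ((ϱ ^ r)⁻¹ * ϱ ^ ν) := by gcongr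
      _ = _ := by ring

theorem summable_lam {r : ℕ} (hr : 1 ≤ r) {ϱ : ℝ} (h0 : 0 < ϱ) (h1 : ϱ < 1) :
    Summable fun ν : ℕ => ‖(lam r ν ϱ : ℂ)‖ * ((ν : ℝ) + 1) ^ 3 := by
  refine Summable.of_nonneg_of_le (fun ν => by positivity) (fun ν => ?_)
    ((summable_add_one_pow_mul_geometric (r + 3) h0.le h1).mul_left (r * (ϱ ^ r)⁻¹))
  rw [Complex.norm_real, Real.norm_eq_abs]
  calc |lam r ν ϱ| * ((ν : ℝ) + 1) ^ 3
      ≤ (r * (ϱ ^ r)⁻¹ * (((ν : ℝ) + 1) ^ r * ϱ ^ ν)) * ((ν : ℝ) + 1) ^ 3 := by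
        gcongr; exact abs_lam_le hr h0 h1 ν
    _ = _ := by ring

/-- Abel means need not converge to f in L_∞, but they converge in L_1, hence almost everywhere
along a subsequence, and Fatou's lemma transfers the bound for every p. -/
theorem eLpNorm_sub_multiplierSum_le {p : ℝ≥0∞} {f : ℝ × ℝ → ℂ} (hf : MemLp f 1 μΩ) {c : ℕ → ℂ}
    (hc : Summable fun ν : ℕ => ‖c ν‖ * ((ν : ℝ) + 1) ^ 3) {D : ℝ≥0∞}
    (hD : ∀ y : ℝ, 3 / 4 < y → y < 1 →
      eLpNorm (multiplierSum (fun ν => (y : ℂ) ^ ν * (1 - c ν)) f) p μΩ ≤ D) :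
    eLpNorm (f - multiplierSum c f) p μΩ ≤ D := by
  obtain ⟨y, -, hy, hylim⟩ := exists_seq_strictMono_tendsto' (show (3 / 4 : ℝ) < 1 by norm_num)
  have hylim' : Tendsto y atTop (𝓝[<] 1) :=
    tendsto_nhdsWithin_iff.mpr ⟨hylim, .of_forall fun i => (hy i).2⟩
  have hyn (i : ℕ) : ‖(y i : ℂ)‖ < 1 :=
    norm_ofReal_lt_one (by linarith [(hy i).1]) (hy i).2
  have h1 := (tendsto_eLpNorm_sub_poissonSum hf).comp hylim'
  have h2 : TendstoInMeasure μΩ (fun i => multiplierSum ((y i : ℂ) ^ ·) f) atTop f := by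
    refine tendstoInMeasure_of_tendsto_eLpNorm one_ne_zero
      (fun i => (continuous_poissonSum (hyn i)).aestronglyMeasurable) hf.1 ?_
    simpa only [Function.comp_def, eLpNorm_sub_comm f] using h1
  obtain ⟨ns, hns, hae⟩ := h2.exists_seq_tendsto_ae
  have hyc (i : ℕ) : Summable fun ν : ℕ => ‖(y i : ℂ) ^ ν * c ν‖ * ((ν : ℝ) + 1) ^ 3 := by
    refine Summable.of_nonneg_of_le (fun ν => by positivity) (fun ν => ?_) hc
    rw [norm_mul, norm_pow]
    gcongr
    exact mul_le_of_le_one_left (norm_nonneg _) (pow_le_one₀ (norm_nonneg _) (hyn i).le)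
  have hy1c (i : ℕ) : Summable fun ν : ℕ => ‖(y i : ℂ) ^ ν * (1 - c ν)‖ * ((ν : ℝ) + 1) ^ 3 := by
    refine Summable.of_nonneg_of_le (fun ν => by positivity) (fun ν => ?_)
      ((summable_norm_pow_mul (hyn i)).add (hyc i))
    rw [← add_mul]
    gcongr
    rw [mul_sub, mul_one]
    exact norm_sub_le _ _
  have hsplit (i : ℕ) : multiplierSum (fun ν => (y i : ℂ) ^ ν * (1 - c ν)) f =
      multiplierSum ((y i : ℂ) ^ ·) f - multiplierSum (fun ν => (y i : ℂ) ^ ν * c ν) f := by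
    rw [multiplierSum_eq_tsum f (hy1c i), multiplierSum_eq_tsum f (summable_norm_pow_mul (hyn i)),
      multiplierSum_eq_tsum f (hyc i), ← BoundedContinuousFunction.coe_sub,
      ← (summable_smul_harmonicPart f (summable_norm_pow_mul (hyn i))).tsum_sub
        (summable_smul_harmonicPart f (hyc i))]
    simp only [mul_sub, mul_one, sub_smul]
  have hbd (t : ℝ × ℝ) (ν : ℕ) := norm_sum_J_le (fun k => fourierCoeff f k * φ k t)
    (C := ∫ t, ‖f t‖ ∂μΩ)
    (fun k => by rw [norm_mul, norm_φ, mul_one]; exact norm_fourierCoeff_le f k) ν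
  have hlim (t : ℝ × ℝ) : Tendsto (fun i => multiplierSum (fun ν => (y i : ℂ) ^ ν * c ν) f t) atTop
      (𝓝 (multiplierSum c f t)) := by
    refine tendsto_tsum_of_dominated_convergence (hc.mul_left ((∫ t, ‖f t‖ ∂μΩ) * 8))
      (fun ν => ?_) (.of_forall fun i ν => ?_)
    · have := (((tendsto_ofReal_one.comp hylim').pow ν).mul_const (c ν)).mul_const
        (∑ k ∈ J ν, fourierCoeff f k * φ k t)
      simpa using this
    · rw [norm_mul, norm_mul, norm_pow]
      calc ‖(y i : ℂ)‖ ^ ν * ‖c ν‖ * ‖∑ k ∈ J ν, fourierCoeff f k * φ k t‖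
          ≤ 1 * ‖c ν‖ * ((∫ t, ‖f t‖ ∂μΩ) * 8 * ((ν : ℝ) + 1) ^ 3) := by
            gcongr
            exacts [pow_le_one₀ (norm_nonneg _) (hyn i).le, hbd t ν]
        _ = _ := by ring
  have hfin := Lp.eLpNorm_lim_le_liminf_eLpNorm (p := p) (μ := μΩ)
    (f := fun i => multiplierSum (fun ν => (y (ns i) : ℂ) ^ ν * (1 - c ν)) f)
    (fun i => by
      rw [multiplierSum_eq_tsum f (hy1c _)]
      exact (BoundedContinuousFunction.continuous _).aestronglyMeasurable)
    (f - multiplierSum c f) ?_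
  · refine hfin.trans ((liminf_le_liminf (.of_forall fun i => hD _ (hy _).1 (hy _).2)).trans_eq
      (liminf_const D))
  · filter_upwards [hae] with t ht
    simp only [hsplit, Pi.sub_apply]
    exact ht.sub ((hlim t).comp hns.tendsto_atTop)

theorem BariStechkin.pos {ω : ℝ → ℝ} (hω : BariStechkin ω) {δ : ℝ} (h0 : 0 < δ) (h1 : δ ≤ 1) :
    0 < ω δ := by
  rw [← hω.map_zero]
  exact hω.strictMonoOn ⟨le_rfl, zero_le_one⟩ ⟨h0.le, h1⟩ h0

/-- An almost optimal decomposition for the `K`-functional. -/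
theorem exists_of_KFunctional_lt {n : ℕ} {δ : ℝ} (hδ : 0 ≤ δ) {g : ℝ × ℝ → ℂ} (hg : MemLp g 1 μΩ)
    {p : ℝ≥0∞} {W : ℝ} (hW : 0 ≤ W) (hK : KFunctional n δ g p < ENNReal.ofReal W) :
    ∃ h d : ℝ × ℝ → ℂ, IsRadialDeriv n h d ∧ MemLp (g - h) p μΩ ∧ MemLp d p μΩ ∧
      (eLpNorm (g - h) p μΩ).toReal + δ ^ n * (eLpNorm d p μΩ).toReal ≤ W := by
  simp only [KFunctional, iInf_lt_iff] at hK
  obtain ⟨h, d, hd, hdp, hlt⟩ := hK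
  have hgh : MemLp (g - h) p μΩ :=
    ⟨hg.1.sub hd.1.1, (le_self_add.trans_lt hlt).trans ENNReal.ofReal_lt_top⟩
  refine ⟨h, d, hd, hgh, hdp, ?_⟩
  have h1 := ENNReal.toReal_mono ENNReal.ofReal_ne_top hlt.le
  rwa [ENNReal.toReal_add hgh.2.ne (ENNReal.mul_ne_top ENNReal.ofReal_ne_top hdp.2.ne),
    ENNReal.toReal_mul, ENNReal.toReal_ofReal (by positivity), ENNReal.toReal_ofReal hW] at h1

/-- The derivative is bounded at the point xy, with w = 1 - xy, while the K-functional is taken at s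
= 1 - x ≤ w. Scaling by s^n/w^n ≤ 1 only helps the term e and turns w^n d into s^n d. -/
theorem pow_mul_le_of_pow_mul_le {n : ℕ} {s w G C e d W : ℝ} (hs : 0 < s) (hsw : s ≤ w)
    (hC : 0 ≤ C) (he : 0 ≤ e) (h1 : w ^ n * G ≤ C * (e + w ^ n * d)) (h2 : e + s ^ n * d ≤ W) :
    s ^ n * G ≤ C * W := by
  have hw : 0 < w ^ n := pow_pos (hs.trans_le hsw) n
  have hsn : 0 < s ^ n := pow_pos hs n
  have hle : s ^ n ≤ w ^ n := by gcongr
  refine le_of_mul_le_mul_left ?_ hw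
  calc w ^ n * (s ^ n * G) = s ^ n * (w ^ n * G) := by ring
    _ ≤ s ^ n * (C * (e + w ^ n * d)) := by gcongr
    _ = C * (s ^ n * e + w ^ n * (s ^ n * d)) := by ring
    _ ≤ C * (w ^ n * e + w ^ n * (s ^ n * d)) := by gcongr
    _ = w ^ n * (C * (e + s ^ n * d)) := by ring
    _ ≤ w ^ n * (C * W) := by gcongr

theorem pow_sub_one_mul_le {m n : ℕ} (hn : 1 ≤ n) {s δ G C W : ℝ} (hs : 0 < s) (hsδ : s ≤ δ)
    (hC : 0 ≤ C * W) (h : s ^ n * G ≤ C * W) :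
    s ^ (m + n - 1) * G ≤ C * δ ^ m * (W / s) := by
  rw [← mul_div_assoc, le_div_iff₀ hs]
  have e : s ^ (m + n - 1) * G * s = s ^ m * (s ^ n * G) := by
    have : s ^ (m + n - 1) * s = s ^ m * s ^ n := by
      rw [← pow_succ, ← pow_add]; congr 1; omega
    linear_combination G * this
  rw [e]
  calc s ^ m * (s ^ n * G) ≤ s ^ m * (C * W) := by gcongr
    _ ≤ δ ^ m * (C * W) := by gcongr
    _ = _ := by ring

end Hexagon

open Hexagon in
theorem mainTheorem2 (p : ℝ≥0∞) (hp : 1 ≤ p) (n r : ℕ) (hn : 1 ≤ n) (hnr : n ≤ r)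
    (ω : ℝ → ℝ) (hω : Hexagon.BariStechkin ω)
    (f g : ℝ × ℝ → ℂ) (hf : MemLp f p Hexagon.μΩ)
    (hg : Hexagon.IsRadialDeriv (r - n) f g)
    (hK : ∃ C : ℝ, ∀ᶠ δ in 𝓝[>] (0 : ℝ),
      Hexagon.KFunctional n δ g p ≤ ENNReal.ofReal (C * ω δ)) :
    ∃ C : ℝ, ∀ᶠ ϱ in 𝓝[<] (1 : ℝ),
      eLpNorm (f - Hexagon.taylorAbelPoisson r ϱ f) p Hexagon.μΩ
        ≤ ENNReal.ofReal (C * ((1 - ϱ) ^ (r - n) * ω (1 - ϱ))) := by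
  have : Fact (1 ≤ p) := ⟨hp⟩
  obtain ⟨m, rfl⟩ := Nat.exists_eq_add_of_le' hnr
  rw [Nat.add_sub_cancel] at hg
  rw [Nat.add_sub_cancel]
  obtain ⟨C₀, hC₀⟩ := hK
  obtain ⟨δ₀, hδ₀, hK⟩ := (mem_nhdsGT_iff_exists_Ioo_subset).mp hC₀
  obtain ⟨C₁, hC₁⟩ := hω.isBigO.bound
  obtain ⟨A, hA, hmain⟩ := exists_norm_powSum_derivCoeff_le p m n
  -- The increment makes the bound on the K-functional strict, as needed to select a decomposition,
  -- and the absolute value covers negative C₀.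
  set C' := |C₀| + 1
  have hC' : 0 < C' := by positivity
  refine ⟨A * C' * C₁, ?_⟩
  have hlim : Tendsto (fun ϱ : ℝ => 1 - ϱ) (𝓝[<] 1) (𝓝[>] 0) := by
    refine tendsto_nhdsWithin_iff.mpr ⟨?_, ?_⟩
    · have : Tendsto (fun ϱ : ℝ => 1 - ϱ) (𝓝 1) (𝓝 0) := by
        simpa using (continuous_const.sub continuous_id).tendsto (1 : ℝ) (f := fun ϱ : ℝ => 1 - ϱ)
      exact this.mono_left nhdsWithin_le_nhds
    · filter_upwards [self_mem_nhdsWithin] with ϱ hϱ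
      simpa using hϱ
  filter_upwards [hlim.eventually hC₁, hlim.eventually (Ioo_mem_nhdsGT hδ₀),
    Ioo_mem_nhdsLT (show (3 / 4 : ℝ) < 1 by norm_num)] with ϱ h1 h2 h3
  have hω0 := hω.pos (δ := 1 - ϱ) (by linarith [h3.2]) (by linarith [h3.1])
  rw [Real.norm_of_nonneg hω0.le] at h1
  have hint : IntervalIntegrable (fun t => ω t / t) volume 0 (1 - ϱ) := by
    rw [intervalIntegrable_iff_integrableOn_Ioc_of_le (by linarith [h3.2])]
    exact hω.integrableOn.mono_set (Ioc_subset_Ioc_right (by linarith [h3.1]))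
  have hint' : IntervalIntegrable (fun x => ω (1 - x) / (1 - x)) volume ϱ 1 := by
    simpa using (hint.comp_sub_left 1).symm
  refine eLpNorm_sub_multiplierSum_le (hf.mono_exponent hp)
    (summable_lam (by omega) (by linarith [h3.1]) h3.2) fun y hy hy1 => ?_
  have hyn : ‖(y : ℂ)‖ < 1 := norm_ofReal_lt_one (by linarith) hy1
  have hs : Summable fun ν : ℕ =>
      ‖(y : ℂ) ^ ν * (1 - (lam (m + n) ν ϱ : ℂ))‖ * ((ν : ℝ) + 1) ^ 3 := by
    refine Summable.of_nonneg_of_le (fun ν => by positivity) (fun ν => ?_)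
      ((summable_norm_pow_mul hyn).add
        (summable_lam (r := m + n) (by omega) (by linarith [h3.1]) h3.2))
    rw [← add_mul]
    gcongr
    rw [mul_sub, mul_one]
    refine (norm_sub_le _ _).trans (add_le_add_right ?_ _)
    rw [norm_mul, norm_pow]
    exact mul_le_of_le_one_left (norm_nonneg _) (pow_le_one₀ (norm_nonneg _) hyn.le)
  rw [eLpNorm_multiplierSum p f hs]
  refine ENNReal.ofReal_le_ofReal ?_
  have hrem := norm_tsum_one_sub_lam_le (polyGrowth_harmonicLp p f) (r := m + n) (by omega)
    (y := y) (ϱ := ϱ) (by linarith) hy1 (by linarith [h3.1]) h3.2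
    (B := fun x => A * C' * (1 - ϱ) ^ m * (ω (1 - x) / (1 - x))) (fun x hx hx1 => ?_)
    (hint'.const_mul _)
  · have e (ν : ℕ) : ((1 - lam (m + n) ν ϱ : ℝ) : ℂ) = 1 - (lam (m + n) ν ϱ : ℂ) := by
      push_cast; rfl
    simp only [e] at hrem
    refine hrem.trans ?_
    rw [intervalIntegral.integral_const_mul,
      intervalIntegral.integral_comp_sub_left (fun t => ω t / t), sub_self]
    calc A * C' * (1 - ϱ) ^ m * ∫ t in (0 : ℝ)..(1 - ϱ), ω t / t
        ≤ A * C' * (1 - ϱ) ^ m * (C₁ * ω (1 - ϱ)) := by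
          have : 0 ≤ 1 - ϱ := by linarith [h3.2]
          gcongr
          exact (le_abs_self _).trans h1
      _ = _ := by ring
  · have hx0 : 0 < 1 - x := by linarith
    have hωx := hω.pos hx0 (by linarith [h3.1])
    have hlt : KFunctional n (1 - x) g p < ENNReal.ofReal (C' * ω (1 - x)) := by
      refine (hK ⟨hx0, by linarith [h2.2]⟩).trans_lt
        ((ENNReal.ofReal_lt_ofReal_iff (by positivity)).mpr ?_)
      gcongr
      linarith [le_abs_self C₀]
    obtain ⟨h, d, hd, hgh, hdp, hle⟩ :=
      exists_of_KFunctional_lt hx0.le hg.2.1 (by positivity) hlt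
    have hxy : x * y ≤ x := mul_le_of_le_one_right (by linarith [h3.1]) hy1.le
    -- Both x and y exceed 3/4, so xy > 9/16 lies in the range of the kernel bound.
    have hxy' : 1 / 2 ≤ x * y := by nlinarith [h3.1]
    have hu := hmain f g h d hg hd hgh hdp (x * y) hxy' (by linarith)
    have := pow_sub_one_mul_le (m := m) (δ := 1 - ϱ) hn hx0 (by linarith) (by positivity)
      (pow_mul_le_of_pow_mul_le hx0 (by linarith) hA ENNReal.toReal_nonneg hu hle)
    refine this.trans_eq ?_
    ring
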